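/- Let $E$ be a locally compact Polish space and consider a pure jump process on $E$ with rates $W(x,dy)=\lambda(x)\,p(x,dy)$, where $\lambda:E\to(0,\infty)$ is bounded and continuous and $p$ is a probability kernel such that $x\mapsto p(x,A)$ is continuous for every Borel set $A$. Let $g\in C_b(E^2)$ with $g(x,x)=0$, $h\in C_b(E)$ and $k,c\in\mathbb{R}$. Put $$\widehat\lambda_k(x)=\int_E W(x,dy)\,e^{kg(x,y)},\qquad \widehat p_k(x,dy)=\frac{W(x,dy)\,e^{kg(x,y)}}{\widehat\lambda_k(x)},\qquad \mathcal V_k=\widehat\lambda_k-\lambda+k h ,$$ and write $a^\pm=\max\{0,\pm a\}$. Fix $K\in\mathbb{N}$. For $N\ge\max\{K,2\}$ let $\pi_{x,n}=\pi^{(N)}_{x,n}\ge 0$ ($x\in E$, $n\in\mathbb N_0$), measurable in $x$, satisfy $\sum_{n=0}^N\pi_{x,n}=1$, $\pi_{x,n}=0$ for $n\ge K$, $\pi_{x,n}=\delta_{n,0}$ if $\mathcal V_k(x)\le c$, and $\sum_{n=1}^N n\,\pi_{x,n}=(\mathcal V_k(x)-c)^+/\widehat\lambda_k(x)$. Put $\pi_x(A)=\pi_{x,|A|}/\binom{N}{|A|}$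 for $A\subseteq\{1,\dots,N\}$ and $Q(x)=\sum_{n=1}^N n^2\pi_{x,n}$. Let $(\zeta^N_t,C^N_t)_{t\ge0}$ be a càdlàg Markov process, with respect to some filtration, on $E^N\times(0,\infty)$ with $C^N_0=1$ and generator $$\overline L^{(N,\star)}_{c,k}F(\underline x,\varsigma)=\sum_{i=1}^N\bigg(\widehat\lambda_k(x_i)\int_E\widehat p_k(x_i,dy)\sum_{A}\pi_{x_i}(A)\big(F(\underline x^{A,x_i;i,y},\varsigma_{|A|})-F(\underline x,\varsigma)\big)+\sum_{j=1}^N\frac{(\mathcal V_k(x_i)-c)^-}{N}\big(F(\underline x^{i,x_j},\varsigma_{-1})-F(\underline x,\varsigma)\big)\bigg),$$ where $A$ runs over all subsets of $\{1,\dots,N\}$, $\varsigma_n=\varsigma(1+n/N)$, $\underline x^{i,w}$ is $\underline x$ with $i$-th entry replaced by $w$, and $\underline x^{A,x_i;i,y}$ is $\underline x$ with the $i$-th entry replaced by $y$ and the entries with index in $A\setminus\{i\}$ replaced by $x_i$. Let $\mu^N_s=\frac1N\sum_{i=1}^N\delta_{\zeta^{N,i}_s}$ and $H(\underline x,\varsigma)=\log\varsigma$.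 Then the process $$\mathcal M^\star_t:=\log C^N_t-\int_0^t\overline L^{(N,\star)}_{c,k}(H)(\zeta^N_s,C^N_s)\,ds$$ is a local martingale, it satisfies $$\mathcal M^\star_t=\log C^N_t-\int_0^t\big(\mu^N_s(\mathcal V_k)-c\big)\,ds+t\cdot O\Big(\frac1N\Big),$$ and its predictable quadratic variation is $$\langle\mathcal M^\star\rangle_t=\frac1N\int_0^t\mu^N_s\big(\widehat\lambda_k\,Q+(\mathcal V_k-c)^-\big)\,ds+t\cdot O\Big(\frac1{N^2}\Big).$$ Here $O(N^{-1})$ and $O(N^{-2})$ denote terms bounded in absolute value by $B/N$ and $B/N^2$ with a constant $B$ that depends only on $\lambda,p,g,h,k,c,K$, and not on $N\ge\max\{K,2\}$, $t\ge 0$, or the realization. -/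

import Mathlib

open MeasureTheory ProbabilityTheory Filter Set Topology
open scoped NNReal ENNReal BoundedContinuousFunction

noncomputable section

namespace Cloning

/-! ### The jump process, the observable and the tilted dynamics -/

/-- A pure jump process on `E` with escape rate `rate` and jump kernel `jump`, together with the
functions `g`, `h` of the time-additive observable
`A_T = T⁻¹ ∑_{jumps t ≤ T} g (X_{t-}, X_t) + T⁻¹ ∫₀ᵀ h (X_t) dt`. -/
structure JumpModel (E : Type*) [TopologicalSpace E] [MeasurableSpace E] where
  rate : E →ᵇ ℝ
  rate_pos : ∀ x, 0 < rate x
  jump : Kernel E E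
  jump_markov : IsMarkovKernel jump
  jump_continuous : ∀ A : Set E, MeasurableSet A → Continuous fun x => jump x A
  g : (E × E) →ᵇ ℝ
  g_diag : ∀ x, g (x, x) = 0
  h : E →ᵇ ℝ

variable {E : Type*} [TopologicalSpace E] [MeasurableSpace E]

/-- The transition rates `W(x, dy) = λ(x) p(x, dy)`. -/
def JumpModel.W (D : JumpModel E) (x : E) : Measure E :=
  ENNReal.ofReal (D.rate x) • D.jump x

/-- The tilted escape rate `λ̂_k(x) = ∫ W(x, dy) e^{k g(x, y)}`. -/
def JumpModel.tiltedRate (D : JumpModel E) (k : ℝ) (x : E) : ℝ :=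
  ∫ y, Real.exp (k * D.g (x, y)) ∂D.W x

/-- The tilted jump distribution `p̂_k(x, dy) = W(x, dy) e^{k g(x, y)} / λ̂_k(x)`
(`μ.tilted f` is the measure `e^f μ / ∫ e^f dμ`). -/
def JumpModel.tiltedJump (D : JumpModel E) (k : ℝ) (x : E) : Measure E :=
  (D.W x).tilted fun y => k * D.g (x, y)

/-- The potential `V_k = λ̂_k - λ + k h`. -/
def JumpModel.potential (D : JumpModel E) (k : ℝ) (x : E) : ℝ :=
  D.tiltedRate k x - D.rate x + k * D.h x

/-- The positive part `(V_k - c)⁺`. -/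
def JumpModel.excess (D : JumpModel E) (k c : ℝ) (x : E) : ℝ := max 0 (D.potential k x - c)

/-- The negative part `(V_k - c)⁻`. -/
def JumpModel.deficit (D : JumpModel E) (k c : ℝ) (x : E) : ℝ := max 0 (-(D.potential k x - c))

/-! ### The clone size distribution -/

/-- `w x n` is the probability that a mutation event of a particle in state `x` produces `n`
clones, in a population of size `N`; fewer than `K` clones are produced, and the mean number
of clones is `(V_k - c)⁺ / λ̂_k`. -/
structure IsCloneSizeDistribution (D : JumpModel E) (k c : ℝ) (K N : ℕ) (w : E → ℕ → ℝ) :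
    Prop where
  measurable : ∀ n, Measurable fun x => w x n
  nonneg : ∀ x n, 0 ≤ w x n
  sum_eq_one : ∀ x, ∑ n ∈ Finset.range (N + 1), w x n = 1
  eq_delta : ∀ x, D.potential k x ≤ c → ∀ n, w x n = if n = 0 then 1 else 0
  bounded_support : ∀ x n, K ≤ n → w x n = 0
  mean : ∀ x, ∑ n ∈ Finset.Icc 1 N, (n : ℝ) * w x n = D.excess k c x / D.tiltedRate k x

/-- The probability that the set `A` of particles is replaced. -/
def cloneSetProb {N : ℕ} (w : E → ℕ → ℝ) (x : E) (A : Finset (Fin N)) : ℝ :=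
  w x A.card / (N.choose A.card : ℝ)

/-- The second moment of the clone size distribution. -/
def secondMoment (N : ℕ) (w : E → ℕ → ℝ) (x : E) : ℝ :=
  ∑ n ∈ Finset.Icc 1 N, (n : ℝ) ^ 2 * w x n

/-! ### The extended cloning generator -/

/-- Particle configurations together with the value of the cloning factor:
`E^N × (0, ∞)`. -/
abbrev State (E : Type*) (N : ℕ) : Type _ := (Fin N → E) × Ioi (0 : ℝ)

/-- Every particle in `A` is replaced by a copy of particle `i`, and then particle `i` moves
to `y`. -/
def cloneMutate {N : ℕ} (x : Fin N → E) (A : Finset (Fin N)) (i : Fin N) (y : E) : Fin N → E :=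
  fun j => if j = i then y else if j ∈ A then x i else x j

/-- The update `ς ↦ ς (1 + n / N)` of the cloning factor. -/
def rescale (N : ℕ) (s : Ioi (0 : ℝ)) (n : ℤ) (hn : -(N : ℤ) < n) : Ioi (0 : ℝ) :=
  ⟨s * (1 + n / N), by
    have hs : (0 : ℝ) < s := s.2
    rcases Nat.eq_zero_or_pos N with rfl | hN
    · simp
    · have hN' : (0 : ℝ) < N := by exact_mod_cast hN
      have hn' : -(N : ℝ) < n := by exact_mod_cast hn
      have : -1 < (n : ℝ) / N := by rw [lt_div_iff₀ hN']; linarith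
      exact mul_pos hs (by linarith)⟩

/-- The generator of the cloning algorithm joint with the cloning factor. -/
def generator (D : JumpModel E) (k c : ℝ) {N : ℕ} (hN : 2 ≤ N) (w : E → ℕ → ℝ)
    (F : State E N → ℝ) (z : State E N) : ℝ :=
  ∑ i : Fin N,
    (D.tiltedRate k (z.1 i) *
        ∫ y, ∑ A : Finset (Fin N), cloneSetProb w (z.1 i) A *
          (F (cloneMutate z.1 A i y, rescale N z.2 A.card (by omega)) - F z)
          ∂D.tiltedJump k (z.1 i)
      + ∑ j : Fin N, D.deficit k c (z.1 i) / N *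
          (F (Function.update z.1 i (z.1 j), rescale N z.2 (-1) (by omega)) - F z))

/-- The empirical distribution `m(x) = N⁻¹ ∑ᵢ δ_{xᵢ}`. -/
def empirical {N : ℕ} (x : Fin N → E) : Measure E :=
  (N : ℝ≥0∞)⁻¹ • ∑ i, Measure.dirac (x i)

/-! ### Stochastic processes -/

/-- Right-continuous with left limits. -/
def IsCadlagPath {S : Type*} [TopologicalSpace S] (u : ℝ≥0 → S) : Prop :=
  (∀ t, ContinuousWithinAt u (Ici t) t) ∧ ∀ t, 0 < t → ∃ l, Tendsto u (𝓝[<] t) (𝓝 l)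

variable {Ω : Type*} {mΩ : MeasurableSpace Ω}

/-- A Markov semigroup of kernels on `S` whose infinitesimal generator (in the Hille-Yosida
sense: uniform limit of difference quotients) is `L` on all bounded continuous functions. -/
structure IsMarkovSemigroup {S : Type*} [TopologicalSpace S] [MeasurableSpace S]
    (L : (S → ℝ) → S → ℝ) (κ : ℝ≥0 → Kernel S S) : Prop where
  markov : ∀ t, IsMarkovKernel (κ t)
  zero : κ 0 = Kernel.id
  add : ∀ s t, κ (s + t) = κ t ∘ₖ κ s
  generator : ∀ F : S →ᵇ ℝ,
    TendstoUniformly (fun (t : ℝ≥0) z => (∫ z', F z' ∂κ t z - F z) / t) (L F) (𝓝[>] 0)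

/-- `X` is a càdlàg Markov process with respect to the filtration `𝓕`, with generator `L`. -/
structure IsMarkovWithGenerator {S : Type*} [TopologicalSpace S] [MeasurableSpace S]
    (L : (S → ℝ) → S → ℝ) (𝓕 : Filtration ℝ≥0 mΩ) (P : Measure Ω) (X : ℝ≥0 → Ω → S) :
    Prop where
  adapted : ∀ t, Measurable[𝓕 t] (X t)
  cadlag : ∀ ω, IsCadlagPath fun t => X t ω
  exists_semigroup : ∃ κ : ℝ≥0 → Kernel S S, IsMarkovSemigroup L κ ∧
    ∀ (s t : ℝ≥0) (F : S →ᵇ ℝ),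
      P[fun ω => F (X (s + t) ω) | 𝓕 s] =ᵐ[P] fun ω => ∫ z, F z ∂κ t (X s ω)

/-- Local martingales: there is a localizing sequence of stopping times such that the stopped
processes are càdlàg martingales. -/
def IsLocalMartingale (M : ℝ≥0 → Ω → ℝ) (𝓕 : Filtration ℝ≥0 mΩ) (P : Measure Ω) : Prop :=
  Locally (fun Y : ℝ≥0 → Ω → ℝ => Martingale Y 𝓕 P ∧ ∀ ω, IsCadlagPath fun t => Y t ω) 𝓕 M P

/-- `A` is (a version of) the predictable quadratic variation `⟨M⟩`: the predictable,
càdlàg, non-decreasing process started at `0` for which `M² - A` is a local martingale. -/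
structure IsPredictableQuadraticVariation (M A : ℝ≥0 → Ω → ℝ) (𝓕 : Filtration ℝ≥0 mΩ)
    (P : Measure Ω) : Prop where
  predictable : IsStronglyPredictable 𝓕 A
  zero : ∀ ω, A 0 ω = 0
  cadlag : ∀ ω, IsCadlagPath fun t => A t ω
  mono : ∀ ω, Monotone fun t => A t ω
  localMartingale : IsLocalMartingale (fun t ω => M t ω ^ 2 - A t ω) 𝓕 P

/-- `M⋆_t = log C_t - ∫₀ᵗ L(H)(ζ_s, C_s) ds`, where `H(x, ς) = log ς`. -/
def compensatedLogFactor (D : JumpModel E) (k c : ℝ) {N : ℕ} (hN : 2 ≤ N) (w : E → ℕ → ℝ)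
    (ζ : ℝ≥0 → Ω → Fin N → E) (C : ℝ≥0 → Ω → Ioi (0 : ℝ)) (t : ℝ≥0) (ω : Ω) : ℝ :=
  Real.log (C t ω) -
    ∫ s in (0 : ℝ)..t, generator D k c hN w (fun z => Real.log z.2)
      (ζ s.toNNReal ω, C s.toNNReal ω)

end Cloning

end

set_option linter.unusedSectionVars false

namespace Cloning

/-! ### Measurability of right-continuous and of continuous processes -/

/-! Seen through `log ς` alone, the cloning dynamics has finitely many jump types: an event with `n`
clones adds `log (1 + n/N)`, a selection event adds `log (1 - 1/N)`, and neither the new state `y`,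
nor the identity of the set `A`, nor the index of the copied particle matters. So on functions `ψ
(log ς)` the generator is `∑ⱼ rⱼ(z) (ψ (ℓ + aⱼ) - ψ ℓ)` with bounded rates (`generator_comp_log`,
`isJumpFunctional_log`).

For bounded continuous functions, uniform convergence of the difference quotients gives Dynkin's
formula (`IsMarkovWithGenerator.dynkin`). The logarithm is unbounded, so it is truncated. The
truncation is 1-Lipschitz, which makes the jump sums of the truncated identity bounded, and those of
the truncated square affine in `|ℓ|`, uniformly in the truncation level. First and then second
moments follow by Fatou without a Gronwall argument, and dominated convergence gives Dynkin's
formula for `y` and `y²` (`dynkin_of_growth`).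

Hence `M = ℓ - ∫ ∑ⱼ rⱼ aⱼ` and `M² - ∫ ∑ⱼ rⱼ aⱼ²` are true martingales (`martingale`,
`martingale_sq`). The second compensator is continuous and adapted, therefore predictable, so it is
the bracket.

What remains is deterministic. With `log (1 + x)` replaced by `x` and its square by `x²`, the two
sums are exactly `μ(V_k) - c` and `N⁻¹ μ(λ̂_k Q + (V_k - c)⁻)`. The errors are `O(x²)` and `O(x³)`
with `|x| = O(1/N)`; summed over `N` particles with bounded rates they are `O(1/N)` and `O(1/N²)`
(`abs_sum_factorRate_mul_le`). -/

theorem measurable_uncurry_of_rightContinuous {Ω S : Type*} [MeasurableSpace Ω]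
    [TopologicalSpace S] [TopologicalSpace.PseudoMetrizableSpace S] [MeasurableSpace S]
    [BorelSpace S] {X : ℝ≥0 → Ω → S} (hX : ∀ t, Measurable (X t))
    (hc : ∀ ω t, ContinuousWithinAt (fun s => X s ω) (Ici t) t) :
    Measurable fun p : ℝ≥0 × Ω => X p.1 p.2 := by
  -- Grid points approaching `s` from the right. The time-discretized process factors through the
  -- countable index `⌊s (n + 1)⌋₊`, which gives joint measurability.
  let d : ℕ → ℝ≥0 → ℝ≥0 := fun n s => ((⌊s * ((n : ℝ≥0) + 1)⌋₊ : ℝ≥0) + 1) / (n + 1)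
  have hpos : ∀ n : ℕ, (0 : ℝ≥0) < n + 1 := fun n => by positivity
  have hle : ∀ n s, s ≤ d n s := fun n s => by
    rw [le_div_iff₀ (hpos n)]
    exact (Nat.lt_floor_add_one _).le
  have hd : ∀ s, Tendsto (fun n => d n s) atTop (𝓝 s) := fun s => by
    have hup : ∀ n, d n s ≤ s + 1 / ((n : ℝ≥0) + 1) := fun n => by
      rw [div_le_iff₀ (hpos n), add_mul, one_div, inv_mul_cancel₀ (hpos n).ne']
      gcongr
      exact Nat.floor_le zero_le
    have h0 : Tendsto (fun n : ℕ => s + 1 / ((n : ℝ≥0) + 1)) atTop (𝓝 s) := by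
      simpa using tendsto_const_nhds.add (tendsto_one_div_add_atTop_nhds_zero_nat (𝕜 := ℝ≥0))
    exact tendsto_of_tendsto_of_tendsto_of_le_of_le tendsto_const_nhds h0 (fun n => hle n s) hup
  refine measurable_of_tendsto_metrizable (f := fun n p => X (d n p.1) p.2) (fun n => ?_) ?_
  · have h1 : Measurable fun q : ℕ × Ω => X (((q.1 : ℝ≥0) + 1) / (n + 1)) q.2 :=
      measurable_from_prod_countable_right fun m => hX (((m : ℝ≥0) + 1) / (n + 1))
    have h2 : Measurable fun p : ℝ≥0 × Ω => (⌊p.1 * ((n : ℝ≥0) + 1)⌋₊, p.2) :=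
      (Nat.measurable_floor.comp (measurable_fst.mul_const _)).prodMk measurable_snd
    have h3 := h1.comp h2
    simpa only [Function.comp_def] using h3
  · refine tendsto_pi_nhds.2 fun p => ?_
    exact (hc p.2 p.1).tendsto.comp
      (tendsto_nhdsWithin_iff.2 ⟨hd p.1, Eventually.of_forall fun n => hle n p.1⟩)

theorem isStronglyPredictable_of_continuous {Ω : Type*} {mΩ : MeasurableSpace Ω}
    {𝓕 : Filtration ℝ≥0 mΩ} {A : ℝ≥0 → Ω → ℝ} (hA : ∀ t, Measurable[𝓕 t] (A t))
    (hc : ∀ ω, Continuous fun t => A t ω) : IsStronglyPredictable 𝓕 A := by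
  -- The left endpoint of the cell `(m/(n+1), (m+1)/(n+1)]` containing `s`, so that sampling there
  -- only uses information available at the start of the cell. Truncated subtraction gives `0` at `s
  -- = 0`.
  let d : ℕ → ℝ≥0 → ℝ≥0 := fun n s => ((⌈s * ((n : ℝ≥0) + 1)⌉₊ - 1 : ℕ) : ℝ≥0) / (n + 1)
  have hpos : ∀ n : ℕ, (0 : ℝ≥0) < n + 1 := fun n => by positivity
  have hd : ∀ s, Tendsto (fun n => d n s) atTop (𝓝 s) := fun s => by
    have hlo : ∀ n : ℕ, s - 1 / ((n : ℝ≥0) + 1) ≤ d n s := fun n => by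
      rw [tsub_le_iff_right, ← add_div, le_div_iff₀ (hpos n)]
      refine (Nat.le_ceil _).trans ?_
      have : ⌈s * ((n : ℝ≥0) + 1)⌉₊ ≤ (⌈s * ((n : ℝ≥0) + 1)⌉₊ - 1) + 1 := by omega
      exact_mod_cast this
    have hup : ∀ n, d n s ≤ s := fun n => by
      rw [div_le_iff₀ (hpos n)]
      rcases Nat.eq_zero_or_pos ⌈s * ((n : ℝ≥0) + 1)⌉₊ with h | h
      · simp [h]
      · exact (Nat.lt_ceil.1 (Nat.sub_lt h one_pos)).le
    have h0 : Tendsto (fun n : ℕ => s - 1 / ((n : ℝ≥0) + 1)) atTop (𝓝 s) := by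
      simpa using (tendsto_const_nhds (x := s)).sub
        (tendsto_one_div_add_atTop_nhds_zero_nat (𝕜 := ℝ≥0))
    exact tendsto_of_tendsto_of_tendsto_of_le_of_le h0 tendsto_const_nhds hlo hup
  have hm : Measurable[𝓕.predictable] (Function.uncurry A) := by
    refine @measurable_of_tendsto_metrizable _ _ 𝓕.predictable _ _ _ _
      (fun n p => A (d n p.1) p.2) _ (fun n => ?_) ?_
    · intro U hU
      have : (fun p : ℝ≥0 × Ω => A (d n p.1) p.2) ⁻¹' U = ({⊥} ×ˢ (A 0 ⁻¹' U)) ∪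
          ⋃ m : ℕ, Ioc ((m : ℝ≥0) / (n + 1)) (((m : ℝ≥0) + 1) / (n + 1)) ×ˢ
            (A ((m : ℝ≥0) / (n + 1)) ⁻¹' U) := by
        ext ⟨s, ω⟩
        simp only [mem_preimage, mem_union, mem_prod, mem_singleton_iff, mem_iUnion, mem_Ioc]
        have hiff : ∀ m : ℕ, ((m : ℝ≥0) / (n + 1) < s ∧ s ≤ ((m : ℝ≥0) + 1) / (n + 1)) ↔
            ⌈s * ((n : ℝ≥0) + 1)⌉₊ = m + 1 := fun m => by
          rw [div_lt_iff₀ (hpos n), le_div_iff₀ (hpos n), Nat.ceil_eq_iff (by omega)]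
          simp
        simp only [hiff]
        rcases eq_or_ne s 0 with rfl | hs
        · simp [d]
        · have hs0 : 0 < ⌈s * ((n : ℝ≥0) + 1)⌉₊ :=
            Nat.ceil_pos.2 (mul_pos (pos_iff_ne_zero.2 hs) (hpos n))
          obtain ⟨m, hm⟩ := Nat.exists_eq_add_of_lt hs0
          simp only [zero_add] at hm
          have hb : ¬ s = ⊥ := hs
          simp [d, hm, hb, -bot_eq_zero']
      rw [this]
      refine MeasurableSet.union (m := 𝓕.predictable)
        (measurableSet_predictable_singleton_bot_prod (hA 0 hU)) ?_
      exact MeasurableSet.iUnion (m := 𝓕.predictable) fun m =>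
        measurableSet_predictable_Ioc_prod _ _ (hA _ hU)
    · exact tendsto_pi_nhds.2 fun p => ((hc p.2).tendsto p.1).comp (hd p.1)
  exact hm.stronglyMeasurable

/-! ### Time integrals of bounded functions of a process -/

section PathIntegral

variable {Ω S : Type*} {mΩ : MeasurableSpace Ω}
    [TopologicalSpace S] [TopologicalSpace.PseudoMetrizableSpace S] [MeasurableSpace S]
    [BorelSpace S] {X : ℝ≥0 → Ω → S} {b : S → ℝ} {B : ℝ}

theorem measurable_comp_path (hX : ∀ t, Measurable (X t))
    (hc : ∀ ω t, ContinuousWithinAt (fun s => X s ω) (Ici t) t) (hb : Measurable b) :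
    Measurable fun p : ℝ × Ω => b (X p.1.toNNReal p.2) :=
  hb.comp ((measurable_uncurry_of_rightContinuous hX hc).comp
    ((measurable_real_toNNReal.comp measurable_fst).prodMk measurable_snd))

/-- A single path is a process over the one-point probability space. -/
theorem measurable_comp_path_right {x : ℝ≥0 → S}
    (hc : ∀ t, ContinuousWithinAt x (Ici t) t) (hb : Measurable b) :
    Measurable fun s : ℝ => b (x s.toNNReal) :=
  (measurable_comp_path (Ω := Unit) (mΩ := ⊤) (X := fun t _ => x t) (fun _ => measurable_const)
    (fun _ t => hc t) hb).comp (measurable_id.prodMk (measurable_const (a := ())))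

theorem intervalIntegrable_of_measurable_of_bound {f : ℝ → ℝ} (hf : Measurable f)
    (hB : ∀ s, |f s| ≤ B) (u v : ℝ) : IntervalIntegrable f volume u v :=
  (intervalIntegrable_const (c := B)).mono_fun hf.aestronglyMeasurable
    (Eventually.of_forall fun s => by
      simpa [Real.norm_eq_abs] using (hB s).trans (le_abs_self B))

theorem measurable_pathIntegral {𝓕 : Filtration ℝ≥0 mΩ} (hX : ∀ t, Measurable[𝓕 t] (X t))
    (hc : ∀ ω t, ContinuousWithinAt (fun s => X s ω) (Ici t) t) (hb : Measurable b) (t : ℝ≥0) :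
    Measurable[𝓕 t] fun ω => ∫ s in (0 : ℝ)..t, b (X s.toNNReal ω) := by
  -- Freezing the path at time `t` makes the integrand jointly measurable for `𝓕 t`, without
  -- changing the integral up to `t`.
  have h1 : @Measurable _ _ (@Prod.instMeasurableSpace ℝ Ω _ (𝓕 t)) _
      (fun p : ℝ × Ω => b (X (min p.1.toNNReal t) p.2)) := by
    refine @measurable_comp_path Ω S (𝓕 t) _ _ _ _ (fun s ω => X (min s t) ω) b
      (fun s => (hX _).mono (𝓕.mono (min_le_right _ _)) le_rfl) (fun ω s => ?_) hb
    exact (hc ω (min s t)).comp (f := fun s => min s t)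
      (continuous_id.min continuous_const).continuousWithinAt
      (fun u hu => min_le_min_right t hu)
  have h2 : (fun ω => ∫ s in (0 : ℝ)..t, b (X s.toNNReal ω)) =
      fun ω => ∫ s, b (X (min s.toNNReal t) ω) ∂(volume.restrict (Ioc (0 : ℝ) t)) := by
    ext ω
    rw [intervalIntegral.integral_of_le (show (0 : ℝ) ≤ (t : ℝ) from t.2)]
    refine setIntegral_congr_fun measurableSet_Ioc fun s hs => ?_
    rw [min_eq_left (Real.toNNReal_le_iff_le_coe.2 hs.2)]
  rw [h2]
  have h3 := @StronglyMeasurable.integral_prod_left' ℝ Ω ℝ _ (𝓕 t)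
    (volume.restrict (Ioc (0 : ℝ) t)) _ _ _ _ h1.stronglyMeasurable
  exact h3.measurable

theorem continuous_pathIntegral {x : ℝ≥0 → S} (hc : ∀ t, ContinuousWithinAt x (Ici t) t)
    (hb : Measurable b) (hB : ∀ z, |b z| ≤ B) :
    Continuous fun t : ℝ≥0 => ∫ s in (0 : ℝ)..t, b (x s.toNNReal) :=
  (intervalIntegral.continuous_primitive (fun u v => intervalIntegrable_of_measurable_of_bound
    (measurable_comp_path_right hc hb) (fun _ => hB _) u v) 0).comp NNReal.continuous_coe

end PathIntegral

theorem abs_pathIntegral_le {S : Type*} {b : S → ℝ} {B : ℝ} (hB : ∀ z, |b z| ≤ B)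
    (x : ℝ≥0 → S) (u v : ℝ) : |∫ s in u..v, b (x s.toNNReal)| ≤ B * |v - u| := by
  simpa [Real.norm_eq_abs] using
    intervalIntegral.norm_integral_le_of_norm_le_const (a := u) (b := v)
      (f := fun s : ℝ => b (x s.toNNReal)) (C := B) fun s _ => by simpa using hB _

/-- This is `(I²)' = 2 I I'`. Since `f` is only measurable and bounded, `I` is differentiable only
almost everywhere, and integration by parts for absolutely continuous functions is needed. -/
theorem integral_primitive_mul {f : ℝ → ℝ} {B : ℝ} (hf : Measurable f) (hB : ∀ s, |f s| ≤ B)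
    {s t : ℝ} (hs : 0 ≤ s) (hst : s ≤ t) :
    2 * ∫ u in s..t, (∫ v in (0 : ℝ)..u, f v) * f u =
      (∫ v in (0 : ℝ)..t, f v) ^ 2 - (∫ v in (0 : ℝ)..s, f v) ^ 2 := by
  have hi := intervalIntegrable_of_measurable_of_bound hf hB 0 t
  set I : ℝ → ℝ := fun u => ∫ v in (0 : ℝ)..u, f v
  have hsub : uIcc s t ⊆ uIcc 0 t := by
    rw [uIcc_of_le hst, uIcc_of_le (hs.trans hst)]
    exact Icc_subset_Icc_left hs
  have hac : AbsolutelyContinuousOnInterval I s t :=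
    (hi.absolutelyContinuousOnInterval_intervalIntegral (c := 0) (by simp)).mono hsub
  have hd : ∀ᵐ u, u ∈ uIoc s t → I u * deriv I u = I u * f u := by
    filter_upwards [hi.ae_hasDerivAt_integral] with u hu hut
    rw [(hu (hsub (uIoc_subset_uIcc hut)) 0 (by simp)).deriv]
  have hp := hac.integral_mul_deriv_eq_deriv_mul hac
  simp only [mul_comm (deriv I _)] at hp
  rw [intervalIntegral.integral_congr_ae hd] at hp
  simp only [I] at hp ⊢
  linarith

theorem intervalIntegral_setIntegral_swap {Ω : Type*} {mΩ : MeasurableSpace Ω} {P : Measure Ω}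
    [IsFiniteMeasure P] {g : Ω → ℝ} (hg : Integrable g P) {f : ℝ × Ω → ℝ} (hf : Measurable f)
    {B : ℝ} {s t : ℝ} (hB : ∀ u ∈ uIoc s t, ∀ ω, |f (u, ω)| ≤ B) (A : Set Ω) :
    ∫ u in s..t, ∫ ω in A, g ω * f (u, ω) ∂P = ∫ ω in A, g ω * (∫ u in s..t, f (u, ω)) ∂P := by
  simp only [← intervalIntegral.integral_const_mul]
  refine intervalIntegral_integral_swap (f := fun u ω => g ω * f (u, ω)) ?_
  have h1 : Integrable (fun p : ℝ × Ω => g p.2)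
      ((volume.restrict (uIoc s t)).prod (P.restrict A)) := by
    have : IsFiniteMeasure ((volume : Measure ℝ).restrict (uIoc s t)) :=
      ⟨by simp [uIoc]⟩
    exact hg.restrict.comp_snd _
  refine h1.mul_bdd (c := B) hf.aestronglyMeasurable ?_
  have h2 : ∀ᵐ p ∂((volume.restrict (uIoc s t)).prod (P.restrict A)), p.1 ∈ uIoc s t :=
    Measure.quasiMeasurePreserving_fst.ae (ae_restrict_mem measurableSet_uIoc)
  filter_upwards [h2] with p hp
  exact hB p.1 hp p.2

/-! ### The Dynkin formula for bounded continuous functions -/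


section Dynkin

variable {Ω S : Type*} {mΩ : MeasurableSpace Ω} {P : Measure Ω} [IsProbabilityMeasure P]
    {𝓕 : Filtration ℝ≥0 mΩ}
    [TopologicalSpace S] [TopologicalSpace.PseudoMetrizableSpace S] [MeasurableSpace S]
    [BorelSpace S] {X : ℝ≥0 → Ω → S} {L : (S → ℝ) → S → ℝ}

theorem IsMarkovWithGenerator.measurable (hX : IsMarkovWithGenerator L 𝓕 P X) (t : ℝ≥0) :
    Measurable (X t) :=
  (hX.adapted t).mono (𝓕.le t) le_rfl

theorem IsMarkovWithGenerator.rightContinuous (hX : IsMarkovWithGenerator L 𝓕 P X) (ω : Ω)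
    (t : ℝ≥0) : ContinuousWithinAt (fun s => X s ω) (Ici t) t :=
  (hX.cadlag ω).1 t

theorem IsMarkovWithGenerator.measurable_generator (hX : IsMarkovWithGenerator L 𝓕 P X)
    (F : S →ᵇ ℝ) : Measurable (L F) := by
  obtain ⟨κ, hκ, -⟩ := hX.exists_semigroup
  have hlim := hκ.generator F
  refine measurable_of_tendsto_metrizable' (𝓝[>] (0 : ℝ≥0))
    (f := fun t z => (∫ z', F z' ∂κ t z - F z) / t) (fun t => ?_)
    (tendsto_pi_nhds.2 fun z => hlim.tendsto_at z)
  have h1 : Measurable fun z => ∫ z', F z' ∂κ t z :=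
    (StronglyMeasurable.integral_kernel (κ := κ t)
      F.continuous.measurable.stronglyMeasurable).measurable
  exact (h1.sub F.continuous.measurable).div_const _

theorem IsMarkovWithGenerator.integrable_comp (hX : IsMarkovWithGenerator L 𝓕 P X)
    {f : S → ℝ} (hf : Measurable f) {B : ℝ} (hB : ∀ z, |f z| ≤ B) (t : ℝ≥0) :
    Integrable (fun ω => f (X t ω)) P :=
  Integrable.of_bound (hf.comp (hX.measurable t)).aestronglyMeasurable B
    (Eventually.of_forall fun _ => hB _)

/-- Short time expansion of expectations under a Markov process with bounded `L F`. -/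
theorem IsMarkovWithGenerator.exists_expansion (hX : IsMarkovWithGenerator L 𝓕 P X)
    (F : S →ᵇ ℝ) {B : ℝ} (hB : ∀ z, |L F z| ≤ B) {ε : ℝ} (hε : 0 < ε) :
    ∃ δ : ℝ, 0 < δ ∧ ∀ (s u v : ℝ≥0) (A : Set Ω), s ≤ u → MeasurableSet[𝓕 s] A → u < v →
      (v : ℝ) - u < δ →
      |(∫ ω in A, F (X v ω) ∂P) - (∫ ω in A, F (X u ω) ∂P)
        - ((v : ℝ) - u) * ∫ ω in A, L F (X u ω) ∂P| ≤ ε * ((v : ℝ) - u) := by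
  have hLm := hX.measurable_generator F
  have hLi := fun t => hX.integrable_comp hLm hB t
  obtain ⟨κ, hκ, hM⟩ := hX.exists_semigroup
  have := hκ.markov
  have hlim := hκ.generator F
  rw [Metric.tendstoUniformly_iff] at hlim
  have h1 := hlim ε hε
  rw [eventually_nhdsWithin_iff, Metric.eventually_nhds_iff] at h1
  obtain ⟨δ, hδ, h1⟩ := h1
  refine ⟨δ, hδ, fun s u v A hsu hA huv hvu => ?_⟩
  set d : ℝ≥0 := v - u with hd
  have hdv : u + d = v := add_tsub_cancel_of_le huv.le
  have hdr : ((d : ℝ≥0) : ℝ) = (v : ℝ) - u := by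
    rw [hd, NNReal.coe_sub huv.le]
  have hd0 : 0 < d := tsub_pos_of_lt huv
  have hd0' : (0 : ℝ) < d := hd0
  have hbound : ∀ z, |∫ z', F z' ∂κ d z - F z - d * L F z| ≤ ε * d := fun z => by
    have hdist : dist d 0 < δ := by
      rw [NNReal.dist_eq, NNReal.coe_zero, sub_zero, abs_of_pos hd0', hdr]
      exact hvu
    have h2 := h1 hdist hd0 z
    rw [dist_comm, Real.dist_eq] at h2
    have h3 : ∫ z', F z' ∂κ d z - F z - d * L F z =
        ((∫ z', F z' ∂κ d z - F z) / d - L F z) * d := by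
      field_simp
    rw [h3, abs_mul, abs_of_pos hd0']
    exact mul_le_mul_of_nonneg_right h2.le hd0'.le
  have hFm := F.continuous.measurable
  have hFi : ∀ t, Integrable (fun ω => F (X t ω)) P :=
    fun t => hX.integrable_comp hFm (fun z => by simpa using F.norm_coe_le_norm z) t
  have hκm : Measurable fun z => ∫ z', F z' ∂κ d z :=
    (StronglyMeasurable.integral_kernel (κ := κ d) hFm.stronglyMeasurable).measurable
  have hκi : Integrable (fun ω => ∫ z, F z ∂κ d (X u ω)) P := by
    refine hX.integrable_comp (f := fun z => ∫ z', F z' ∂κ d z) hκm (B := ‖F‖) (fun z => ?_) u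
    have := norm_integral_le_of_norm_le_const (μ := κ d z) (f := F) (C := ‖F‖)
      (Eventually.of_forall fun z => F.norm_coe_le_norm z)
    simpa using this
  have hAu : MeasurableSet[𝓕 u] A := 𝓕.mono hsu A hA
  -- The Markov property at time `u`; it applies because `A` also belongs to the later σ-algebra `𝓕
  -- u`.
  have hcond : ∫ ω in A, F (X v ω) ∂P = ∫ ω in A, ∫ z, F z ∂κ d (X u ω) ∂P := by
    rw [← setIntegral_condExp (𝓕.le u) (hFi v) hAu, ← hdv]
    exact setIntegral_congr_ae (𝓕.le u A hAu) ((hM u d F).mono fun ω h _ => h)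
  have hdi : Integrable (fun ω => ∫ z, F z ∂κ d (X u ω) - F (X u ω)) P := hκi.sub (hFi u)
  rw [hcond, ← hdr, ← integral_sub hκi.restrict (hFi u).restrict, ← integral_const_mul,
    ← integral_sub hdi.restrict ((hLi u).const_mul _).restrict]
  have h4 := norm_integral_le_of_norm_le_const (μ := P.restrict A)
    (f := fun ω => ∫ z, F z ∂κ d (X u ω) - F (X u ω) - d * L F (X u ω)) (C := ε * d)
    (Eventually.of_forall fun ω => hbound (X u ω))
  refine h4.trans ?_
  have h5 : (P.restrict A).real univ ≤ 1 := by
    rw [measureReal_restrict_apply_univ]; exact measureReal_le_one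
  exact mul_le_of_le_one_right (by positivity) h5

theorem IsMarkovWithGenerator.measurable_setIntegral (hX : IsMarkovWithGenerator L 𝓕 P X)
    {f : S → ℝ} (hf : Measurable f) (A : Set Ω) :
    Measurable fun u : ℝ => ∫ ω in A, f (X u.toNNReal ω) ∂P :=
  (measurable_comp_path hX.measurable hX.rightContinuous
    hf).stronglyMeasurable.integral_prod_right'.measurable

theorem IsMarkovWithGenerator.abs_setIntegral_le (_hX : IsMarkovWithGenerator L 𝓕 P X)
    {f : S → ℝ} {B : ℝ} (hB : ∀ z, |f z| ≤ B) (A : Set Ω) (u : ℝ≥0) :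
    |∫ ω in A, f (X u ω) ∂P| ≤ B := by
  have hB0 : 0 ≤ B := by
    obtain ⟨ω⟩ : Nonempty Ω := P.nonempty_of_neZero
    exact (abs_nonneg _).trans (hB (X u ω))
  have h4 := norm_integral_le_of_norm_le_const (μ := P.restrict A)
    (f := fun ω => f (X u ω)) (C := B) (Eventually.of_forall fun ω => hB (X u ω))
  refine h4.trans (mul_le_of_le_one_right hB0 ?_)
  rw [measureReal_restrict_apply_univ]; exact measureReal_le_one

/-- The function `u ↦ E[F(X_u); A]` is continuous with right derivative `E[L F(X_u); A]`, and the
fundamental theorem of calculus needs no more than a right derivative. -/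
theorem IsMarkovWithGenerator.dynkin (hX : IsMarkovWithGenerator L 𝓕 P X)
    (F : S →ᵇ ℝ) {B : ℝ} (hB : ∀ z, |L F z| ≤ B) {s t : ℝ≥0} (hst : s ≤ t) {A : Set Ω}
    (hA : MeasurableSet[𝓕 s] A) :
    ∫ u in (s : ℝ)..t, ∫ ω in A, L F (X u.toNNReal ω) ∂P =
      (∫ ω in A, F (X t ω) ∂P) - ∫ ω in A, F (X s ω) ∂P := by
  have hLm := hX.measurable_generator F
  set f : ℝ → ℝ := fun u => ∫ ω in A, F (X u.toNNReal ω) ∂P with hf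
  set f' : ℝ → ℝ := fun u => ∫ ω in A, L F (X u.toNNReal ω) ∂P with hf'
  have hf'B : ∀ u, |f' u| ≤ B := fun u => hX.abs_setIntegral_le hB A _
  have hB0 : 0 ≤ B := (abs_nonneg _).trans (hf'B 0)
  have key : ∀ ε : ℝ, 0 < ε → ∃ δ : ℝ, 0 < δ ∧ ∀ u v : ℝ, s ≤ u → u < v → v - u < δ →
      |f v - f u - (v - u) * f' u| ≤ ε * (v - u) := fun ε hε => by
    obtain ⟨δ, hδ, h⟩ := hX.exists_expansion F hB hε
    refine ⟨δ, hδ, fun u v hsu huv hvu => ?_⟩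
    have hu : 0 ≤ u := s.2.trans hsu
    have hv : 0 ≤ v := hu.trans huv.le
    have := h s u.toNNReal v.toNNReal A ((Real.le_toNNReal_iff_coe_le hu).2 hsu) hA
      ((Real.toNNReal_lt_toNNReal_iff_of_nonneg hu).2 huv)
      (by rwa [Real.coe_toNNReal _ hu, Real.coe_toNNReal _ hv])
    rwa [Real.coe_toNNReal _ hu, Real.coe_toNNReal _ hv] at this
  have hst' : (s : ℝ) ≤ t := hst
  have h := intervalIntegral.integral_eq_sub_of_hasDeriv_right_of_le (f := f) (f' := f') hst' ?_ ?_
    (intervalIntegrable_of_measurable_of_bound (hX.measurable_setIntegral hLm A) hf'B _ _)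
  · simpa [hf, hf'] using h
  · obtain ⟨δ, hδ, h⟩ := key 1 one_pos
    -- The expansion is uniform in the base point, so forward increments give a Lipschitz bound at
    -- scale `δ`, hence continuity from the left as well.
    have hlip : ∀ u v : ℝ, s ≤ u → u ≤ v → v - u < δ → |f v - f u| ≤ (B + 1) * (v - u) := by
      intro u v hsu huv hvu
      rcases huv.eq_or_lt with rfl | huv
      · simp
      have h1 := h u v hsu huv hvu
      have h2 : |(v - u) * f' u| ≤ (v - u) * B := by
        rw [abs_mul, abs_of_pos (sub_pos.2 huv)]
        exact mul_le_mul_of_nonneg_left (hf'B u) (sub_pos.2 huv).le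
      have h3 := abs_add_le (f v - f u - (v - u) * f' u) ((v - u) * f' u)
      rw [sub_add_cancel] at h3
      linarith
    rw [Metric.continuousOn_iff]
    intro u hu ε hε
    refine ⟨min δ (ε / (B + 1)), lt_min hδ (by positivity), fun v hv hvu => ?_⟩
    rw [Real.dist_eq] at hvu ⊢
    obtain ⟨h1, h2⟩ := lt_min_iff.1 hvu
    rw [lt_div_iff₀ (by positivity)] at h2
    rcases le_total u v with huv | huv
    · rw [abs_of_nonneg (sub_nonneg.2 huv)] at h1 h2
      have := hlip u v hu.1 huv h1
      linarith
    · rw [abs_sub_comm, abs_of_nonneg (sub_nonneg.2 huv)] at h1 h2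
      rw [abs_sub_comm]
      have := hlip v u hv.1 huv h1
      linarith
  · intro u hu
    rw [hasDerivWithinAt_iff_isLittleO, Asymptotics.isLittleO_iff]
    intro ε hε
    obtain ⟨δ, hδ, h⟩ := key ε hε
    have hmem : Ioo u (u + δ) ∈ 𝓝[>] u := Ioo_mem_nhdsGT (by linarith)
    filter_upwards [hmem] with v hv
    have h1 := h u v hu.1.le hv.1 (by linarith [hv.2])
    simpa [Real.norm_eq_abs, abs_of_pos (sub_pos.2 hv.1)] using h1

end Dynkin

/-! ### Truncation -/

/-- Truncation of a real number to `[-m, m]`. -/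
def truncate (m : ℕ) (y : ℝ) : ℝ := max (-(m : ℝ)) (min m y)

theorem continuous_truncate (m : ℕ) : Continuous (truncate m) :=
  continuous_const.max (continuous_const.min continuous_id)

theorem abs_truncate_le (m : ℕ) (y : ℝ) : |truncate m y| ≤ m :=
  abs_le.2 ⟨le_max_left _ _, max_le (by linarith [Nat.cast_nonneg (α := ℝ) m]) (min_le_left _ _)⟩

theorem abs_truncate_sub_le (m : ℕ) (x y : ℝ) : |truncate m x - truncate m y| ≤ |x - y| := by
  have h1 : |truncate m x - truncate m y| ≤ |min (m : ℝ) x - min (m : ℝ) y| := by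
    have := abs_max_sub_max_le_max (-(m : ℝ)) (min m x) (-m) (min m y)
    simpa [truncate] using this
  have h2 : |min (m : ℝ) x - min (m : ℝ) y| ≤ |x - y| := by
    simpa using abs_min_sub_min_le_max (m : ℝ) x m y
  exact h1.trans h2

theorem truncate_zero (m : ℕ) : truncate m 0 = 0 := by
  simp [truncate]

theorem abs_truncate_le_abs (m : ℕ) (y : ℝ) : |truncate m y| ≤ |y| := by
  simpa [truncate_zero] using abs_truncate_sub_le m y 0

theorem truncate_of_abs_le {m : ℕ} {y : ℝ} (h : |y| ≤ m) : truncate m y = y := by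
  rw [truncate, min_eq_right (abs_le.1 h).2, max_eq_right (abs_le.1 h).1]

theorem tendsto_truncate (y : ℝ) : Tendsto (fun m => truncate m y) atTop (𝓝 y) := by
  refine tendsto_const_nhds.congr' ?_
  filter_upwards [eventually_ge_atTop ⌈|y|⌉₊] with m hm
  exact (truncate_of_abs_le ((Nat.le_ceil _).trans (by exact_mod_cast hm))).symm

/-- The bound does not involve `m`: this is what lets second moments pass to the limit. -/
theorem abs_truncate_sq_sub_le (m : ℕ) (y a : ℝ) :
    |truncate m (y + a) ^ 2 - truncate m y ^ 2| ≤ |a| * (2 * |y| + |a|) := by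
  have h1 := abs_truncate_sub_le m (y + a) y
  rw [add_sub_cancel_left] at h1
  have h2 : |truncate m (y + a) + truncate m y| ≤ 2 * |y| + |a| := by
    have := abs_add_le (truncate m (y + a)) (truncate m y)
    have := abs_truncate_le_abs m (y + a)
    have := abs_truncate_le_abs m y
    have := abs_add_le y a
    linarith
  rw [sq_sub_sq, mul_comm, abs_mul]
  exact mul_le_mul h1 h2 (abs_nonneg _) (abs_nonneg _)

/-- The Fatou lemma for a sequence of nonnegative functions with bounded integrals. -/
theorem integrable_and_integral_le_of_tendsto {Ω : Type*} {mΩ : MeasurableSpace Ω}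
    {P : Measure Ω} {f : ℕ → Ω → ℝ} {g : Ω → ℝ} {c : ℝ} (hf : ∀ m, Measurable (f m))
    (hf0 : ∀ m ω, 0 ≤ f m ω) (hfi : ∀ m, Integrable (f m) P) (hc : ∀ m, ∫ ω, f m ω ∂P ≤ c)
    (hlim : ∀ ω, Tendsto (fun m => f m ω) atTop (𝓝 (g ω))) :
    Integrable g P ∧ ∫ ω, g ω ∂P ≤ c := by
  have hg : Measurable g := measurable_of_tendsto_metrizable hf (tendsto_pi_nhds.2 hlim)
  have hg0 : ∀ ω, 0 ≤ g ω := fun ω => ge_of_tendsto' (hlim ω) fun m => hf0 m ω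
  have hc0 : 0 ≤ c := (integral_nonneg (hf0 0)).trans (hc 0)
  have hle : ∫⁻ ω, ENNReal.ofReal (g ω) ∂P ≤ ENNReal.ofReal c := by
    have h1 : ∀ ω, ENNReal.ofReal (g ω) = liminf (fun m => ENNReal.ofReal (f m ω)) atTop :=
      fun ω => ((ENNReal.continuous_ofReal.tendsto _).comp (hlim ω)).liminf_eq.symm
    simp only [h1]
    refine (lintegral_liminf_le fun m => (hf m).ennreal_ofReal).trans ?_
    refine liminf_le_of_le (by isBoundedDefault) fun b hb => ?_
    obtain ⟨m, hm⟩ := hb.exists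
    refine hm.trans ?_
    rw [← ofReal_integral_eq_lintegral_ofReal (hfi m) (Eventually.of_forall (hf0 m))]
    exact ENNReal.ofReal_le_ofReal (hc m)
  have hgi : Integrable g P := by
    refine ⟨hg.aestronglyMeasurable, ?_⟩
    rw [hasFiniteIntegral_iff_ofReal (Eventually.of_forall hg0)]
    exact hle.trans_lt ENNReal.ofReal_lt_top
  refine ⟨hgi, ?_⟩
  rw [← ofReal_integral_eq_lintegral_ofReal hgi (Eventually.of_forall hg0)] at hle
  exact (ENNReal.ofReal_le_ofReal_iff hc0).1 hle

/-! ### Functionals of a Markov process that evolve by finitely many types of jumps -/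

/-- The jump operator `ψ ↦ ∑ⱼ rⱼ (ψ(ℓ + aⱼ) - ψ(ℓ))`. -/
def jumpSum {S J : Type*} [Fintype J] (ℓ : S → ℝ) (r : J → S → ℝ) (a : J → ℝ) (ψ : ℝ → ℝ)
    (z : S) : ℝ :=
  ∑ j, r j z * (ψ (ℓ z + a j) - ψ (ℓ z))

/-- Under the generator `L` the functional `ℓ` jumps by `a j` at rate `r j ≤ R`. -/
structure IsJumpFunctional {S J : Type*} [TopologicalSpace S] [MeasurableSpace S] [Fintype J]
    (L : (S → ℝ) → S → ℝ) (ℓ : S → ℝ) (r : J → S → ℝ) (a : J → ℝ) (R : ℝ) : Prop where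
  continuous : Continuous ℓ
  measurable_rate : ∀ j, Measurable (r j)
  rate_nonneg : ∀ j z, 0 ≤ r j z
  rate_le : ∀ j z, r j z ≤ R
  generator_eq : ∀ ψ : ℝ → ℝ, Continuous ψ → (∃ c, ∀ y, |ψ y| ≤ c) → ∀ z,
    L (fun z => ψ (ℓ z)) z = jumpSum ℓ r a ψ z

section JumpFunctional

variable {Ω S J : Type*} [Fintype J] {mΩ : MeasurableSpace Ω} {P : Measure Ω}
    [IsProbabilityMeasure P] {𝓕 : Filtration ℝ≥0 mΩ}
    [TopologicalSpace S] [TopologicalSpace.PseudoMetrizableSpace S] [MeasurableSpace S]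
    [BorelSpace S] {X : ℝ≥0 → Ω → S} {L : (S → ℝ) → S → ℝ}
    {ℓ : S → ℝ} {r : J → S → ℝ} {a : J → ℝ} {R : ℝ}

theorem IsJumpFunctional.abs_sum_le (hJ : IsJumpFunctional L ℓ r a R) {d e : J → ℝ}
    (h : ∀ j, |d j| ≤ e j) (z : S) : |∑ j, r j z * d j| ≤ R * ∑ j, e j := by
  rw [Finset.mul_sum]
  refine (Finset.abs_sum_le_sum_abs _ _).trans (Finset.sum_le_sum fun j _ => ?_)
  rw [abs_mul, abs_of_nonneg (hJ.rate_nonneg j z)]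
  exact mul_le_mul (hJ.rate_le j z) (h j) (abs_nonneg _)
    ((hJ.rate_nonneg j z).trans (hJ.rate_le j z))

theorem IsJumpFunctional.measurable_jumpSum (hJ : IsJumpFunctional L ℓ r a R) {ψ : ℝ → ℝ}
    (hψ : Continuous ψ) : Measurable (jumpSum ℓ r a ψ) := by
  have hm := hJ.continuous.measurable
  exact Finset.measurable_sum _ fun j _ => (hJ.measurable_rate j).mul
    ((hψ.measurable.comp (hm.add_const _)).sub (hψ.measurable.comp hm))

theorem IsMarkovWithGenerator.dynkin_comp (hX : IsMarkovWithGenerator L 𝓕 P X)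
    (hJ : IsJumpFunctional L ℓ r a R) {ψ : ℝ → ℝ} (hψ : Continuous ψ) {c : ℝ}
    (hc : ∀ y, |ψ y| ≤ c) {s t : ℝ≥0} (hst : s ≤ t) {A : Set Ω} (hA : MeasurableSet[𝓕 s] A) :
    ∫ u in (s : ℝ)..t, ∫ ω in A, jumpSum ℓ r a ψ (X u.toNNReal ω) ∂P =
      (∫ ω in A, ψ (ℓ (X t ω)) ∂P) - ∫ ω in A, ψ (ℓ (X s ω)) ∂P := by
  let F : S →ᵇ ℝ := BoundedContinuousFunction.ofNormedAddCommGroup (fun z => ψ (ℓ z))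
    (hψ.comp hJ.continuous) c fun z => hc _
  have hF : L F = jumpSum ℓ r a ψ := funext fun z => hJ.generator_eq ψ hψ ⟨c, hc⟩ z
  have h := hX.dynkin F (B := R * ∑ _j : J, (2 * c)) (fun z => ?_) hst hA
  · rw [hF] at h
    exact h
  · rw [hF]
    refine hJ.abs_sum_le (fun j => ?_) z
    have := abs_sub (ψ (ℓ z + a j)) (ψ (ℓ z))
    linarith [hc (ℓ z + a j), hc (ℓ z)]

theorem IsMarkovWithGenerator.integrable_bounded_comp (hX : IsMarkovWithGenerator L 𝓕 P X)
    (hJ : IsJumpFunctional L ℓ r a R) {ψ : ℝ → ℝ} (hψ : Continuous ψ) {c : ℝ}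
    (hc : ∀ y, |ψ y| ≤ c) (t : ℝ≥0) : Integrable (fun ω => ψ (ℓ (X t ω))) P :=
  hX.integrable_comp (f := fun z => ψ (ℓ z)) (hψ.comp hJ.continuous).measurable (fun _ => hc _) t

theorem IsMarkovWithGenerator.integrable_bounded_jumpSum (hX : IsMarkovWithGenerator L 𝓕 P X)
    (hJ : IsJumpFunctional L ℓ r a R) {ψ : ℝ → ℝ} (hψ : Continuous ψ) {c : ℝ}
    (hc : ∀ y, |ψ y| ≤ c) (t : ℝ≥0) : Integrable (fun ω => jumpSum ℓ r a ψ (X t ω)) P := by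
  refine hX.integrable_comp (hJ.measurable_jumpSum hψ) (B := R * ∑ _j : J, (2 * c)) (fun z => ?_) t
  refine hJ.abs_sum_le (fun j => ?_) z
  have := abs_sub (ψ (ℓ z + a j)) (ψ (ℓ z))
  linarith [hc (ℓ z + a j), hc (ℓ z)]

/-- A bound on the mean of `jumpSum ψ` bounds the mean of a bounded function `ψ` of the
functional. -/
theorem IsMarkovWithGenerator.integral_comp_le (hX : IsMarkovWithGenerator L 𝓕 P X)
    (hJ : IsJumpFunctional L ℓ r a R) (h0 : ∀ᵐ ω ∂P, ℓ (X 0 ω) = 0) {ψ : ℝ → ℝ}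
    (hψ : Continuous ψ) {c : ℝ} (hc : ∀ y, |ψ y| ≤ c) (hψ0 : ψ 0 = 0) {C : ℝ} {t : ℝ≥0}
    (hC : ∀ u ≤ t, ∫ ω, jumpSum ℓ r a ψ (X u ω) ∂P ≤ C) :
    ∫ ω, ψ (ℓ (X t ω)) ∂P ≤ C * t := by
  have h := hX.dynkin_comp hJ hψ hc (zero_le (a := t)) MeasurableSet.univ
  simp only [Measure.restrict_univ] at h
  have hz : ∫ ω, ψ (ℓ (X 0 ω)) ∂P = 0 := by
    rw [integral_congr_ae (g := fun _ => (0 : ℝ)) (by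
      filter_upwards [h0] with ω hω
      simp [hω, hψ0])]
    simp
  rw [hz, sub_zero] at h
  rw [← h]
  have hle : (((0 : ℝ≥0) : ℝ)) ≤ t := t.2
  have hm := hX.measurable_setIntegral (hJ.measurable_jumpSum (r := r) (a := a) hψ) univ
  simp only [Measure.restrict_univ] at hm
  have hb := fun u => hX.abs_setIntegral_le (f := jumpSum ℓ r a ψ) (B := R * ∑ _j : J, (2 * c))
    (fun z => hJ.abs_sum_le (fun j => by
      have := abs_sub (ψ (ℓ z + a j)) (ψ (ℓ z))
      linarith [hc (ℓ z + a j), hc (ℓ z)]) z) univ u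
  simp only [Measure.restrict_univ] at hb
  have h2 := intervalIntegral.integral_mono_on hle
    (intervalIntegrable_of_measurable_of_bound hm (fun u => hb _) _ _)
    (intervalIntegrable_const (c := C)) fun u hu => hC _ (Real.toNNReal_le_iff_le_coe.2 hu.2)
  simpa [mul_comm] using h2

/-- Since `|truncate m ·|` is 1-Lipschitz, its jump sum is at most `R ∑ |a j|` for every `m`;
Fatou's lemma removes the truncation. -/
theorem IsMarkovWithGenerator.first_moment (hX : IsMarkovWithGenerator L 𝓕 P X)
    (hJ : IsJumpFunctional L ℓ r a R) (h0 : ∀ᵐ ω ∂P, ℓ (X 0 ω) = 0) (t : ℝ≥0) :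
    Integrable (fun ω => ℓ (X t ω)) P ∧
      ∫ ω, |ℓ (X t ω)| ∂P ≤ R * (∑ j, |a j|) * t := by
  have hm : Measurable fun ω => ℓ (X t ω) := hJ.continuous.measurable.comp (hX.measurable t)
  have hc : ∀ m : ℕ, Continuous fun y => |truncate m y| := fun m => (continuous_truncate m).abs
  have hb : ∀ (m : ℕ) (y : ℝ), |(|truncate m y|)| ≤ m := fun m y => by
    rw [abs_abs]; exact abs_truncate_le m y
  have h := integrable_and_integral_le_of_tendsto (P := P)
    (f := fun m ω => |truncate m (ℓ (X t ω))|) (g := fun ω => |ℓ (X t ω)|)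
    (c := R * (∑ j, |a j|) * t) (fun m => (hc m).measurable.comp hm)
    (fun m ω => abs_nonneg _) (fun m => hX.integrable_bounded_comp hJ (hc m) (hb m) t)
    (fun m => ?_) (fun ω => (tendsto_truncate _).abs)
  · exact ⟨(integrable_norm_iff hm.aestronglyMeasurable).1 h.1, h.2⟩
  · refine hX.integral_comp_le hJ h0 (hc m) (hb m) (by simp [truncate_zero]) fun u _ => ?_
    have h1 := hX.abs_setIntegral_le (f := jumpSum ℓ r a fun y => |truncate m y|)
      (B := R * ∑ j, |a j|) (fun z => hJ.abs_sum_le (fun j => ?_) z) univ u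
    · simpa using (abs_le.1 h1).2
    · refine (abs_abs_sub_abs_le_abs_sub _ _).trans ?_
      simpa using abs_truncate_sub_le m (ℓ z + a j) (ℓ z)

/-- Mean of an increment bound that is affine in the functional. -/
theorem IsMarkovWithGenerator.integral_affine_le (hX : IsMarkovWithGenerator L 𝓕 P X)
    (hJ : IsJumpFunctional L ℓ r a R) (h0 : ∀ᵐ ω ∂P, ℓ (X 0 ω) = 0) {p q : ℝ} (hp : 0 ≤ p)
    {u t : ℝ≥0} (hut : u ≤ t) :
    Integrable (fun ω => p * |ℓ (X u ω)| + q) P ∧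
      ∫ ω, (p * |ℓ (X u ω)| + q) ∂P ≤ p * (R * (∑ j, |a j|) * t) + q := by
  obtain ⟨hi, hle⟩ := hX.first_moment hJ h0 u
  have hR : 0 ≤ R * ∑ j, |a j| := by
    obtain ⟨ω⟩ : Nonempty Ω := P.nonempty_of_neZero
    exact (abs_nonneg _).trans (hJ.abs_sum_le (d := a) (fun j => le_rfl) (X u ω))
  have hi' : Integrable (fun ω => p * |ℓ (X u ω)|) P := hi.abs.const_mul p
  refine ⟨hi'.add (integrable_const q), ?_⟩
  rw [integral_add hi' (integrable_const q), integral_const_mul]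
  have h1 : R * (∑ j, |a j|) * u ≤ R * (∑ j, |a j|) * t :=
    mul_le_mul_of_nonneg_left (NNReal.coe_le_coe.2 hut) hR
  have h2 := mul_le_mul_of_nonneg_left (hle.trans h1) hp
  simpa using h2

/-- The jump sum of the truncated square is affine in `|ℓ|`, so the first-moment bound already
controls its mean on `[0, t]`, uniformly in `m`. -/
theorem IsMarkovWithGenerator.integrable_sq (hX : IsMarkovWithGenerator L 𝓕 P X)
    (hJ : IsJumpFunctional L ℓ r a R) (h0 : ∀ᵐ ω ∂P, ℓ (X 0 ω) = 0) (t : ℝ≥0) :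
    Integrable (fun ω => ℓ (X t ω) ^ 2) P := by
  have hm : Measurable fun ω => ℓ (X t ω) := hJ.continuous.measurable.comp (hX.measurable t)
  have hc : ∀ m : ℕ, Continuous fun y => truncate m y ^ 2 := fun m => (continuous_truncate m).pow 2
  have hb : ∀ (m : ℕ) (y : ℝ), |truncate m y ^ 2| ≤ (m : ℝ) ^ 2 := fun m y => by
    rw [abs_pow]; exact pow_le_pow_left₀ (abs_nonneg _) (abs_truncate_le m y) 2
  have hR : 0 ≤ R * ∑ j, |a j| := by
    obtain ⟨ω⟩ : Nonempty Ω := P.nonempty_of_neZero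
    exact (abs_nonneg _).trans (hJ.abs_sum_le (d := a) (fun j => le_rfl) (X 0 ω))
  refine (integrable_and_integral_le_of_tendsto (P := P)
    (f := fun m ω => truncate m (ℓ (X t ω)) ^ 2) (g := fun ω => ℓ (X t ω) ^ 2)
    (c := (2 * (R * ∑ j, |a j|) * (R * (∑ j, |a j|) * t) + R * ∑ j, |a j| * |a j|) * t)
    (fun m => (hc m).measurable.comp hm)
    (fun m ω => sq_nonneg _) (fun m => hX.integrable_bounded_comp hJ (hc m) (hb m) t)
    (fun m => ?_) (fun ω => (tendsto_truncate _).pow 2)).1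
  refine hX.integral_comp_le hJ h0 (hc m) (hb m) (by simp [truncate_zero]) fun u hu => ?_
  obtain ⟨hi, hle⟩ := hX.integral_affine_le hJ h0 (p := 2 * (R * ∑ j, |a j|))
    (q := R * ∑ j, |a j| * |a j|) (by positivity) hu
  refine (integral_mono (hX.integrable_bounded_jumpSum hJ (hc m) (hb m) u) hi fun ω => ?_).trans hle
  refine (le_abs_self _).trans ((hJ.abs_sum_le (fun j => abs_truncate_sq_sub_le m _ (a j))
    (X u ω)).trans (le_of_eq ?_))
  simp only [mul_add, Finset.sum_add_distrib, ← Finset.sum_mul]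
  ring

/-- The Dynkin formula for functions of at most quadratic growth. -/
theorem IsMarkovWithGenerator.dynkin_of_growth (hX : IsMarkovWithGenerator L 𝓕 P X)
    (hJ : IsJumpFunctional L ℓ r a R) (h0 : ∀ᵐ ω ∂P, ℓ (X 0 ω) = 0) {ψ : ℝ → ℝ}
    (hψ : Continuous ψ) (hgrowth : ∀ y, |ψ y| ≤ 1 + y ^ 2)
    (hinc : ∀ m y b, |ψ (truncate m (y + b)) - ψ (truncate m y)| ≤ |b| * (2 * |y| + (1 + |b|)))
    {s t : ℝ≥0} (hst : s ≤ t) {A : Set Ω} (hA : MeasurableSet[𝓕 s] A) :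
    ∫ u in (s : ℝ)..t, ∫ ω in A, jumpSum ℓ r a ψ (X u.toNNReal ω) ∂P =
      (∫ ω in A, ψ (ℓ (X t ω)) ∂P) - ∫ ω in A, ψ (ℓ (X s ω)) ∂P := by
  -- The extra `1` in `hgrowth` and `hinc` is slack that lets one statement cover both `ψ y = y` and
  -- `ψ y = y ^ 2`.
  have hc : ∀ m : ℕ, Continuous fun y => ψ (truncate m y) := fun m =>
    hψ.comp (continuous_truncate m)
  have hsq : ∀ (m : ℕ) (y : ℝ), truncate m y ^ 2 ≤ y ^ 2 := fun m y => by
    rw [← sq_abs, ← sq_abs y]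
    exact pow_le_pow_left₀ (abs_nonneg _) (abs_truncate_le_abs m y) 2
  have hb : ∀ (m : ℕ) (y : ℝ), |ψ (truncate m y)| ≤ 1 + (m : ℝ) ^ 2 := fun m y => by
    refine (hgrowth _).trans (add_le_add_right ?_ _)
    rw [← sq_abs]
    exact pow_le_pow_left₀ (abs_nonneg _) (abs_truncate_le m y) 2
  have hdyn : ∀ m : ℕ, _ := fun m => hX.dynkin_comp hJ (hc m) (hb m) hst hA
  have hR : 0 ≤ R * ∑ j, |a j| := by
    obtain ⟨ω⟩ : Nonempty Ω := P.nonempty_of_neZero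
    exact (abs_nonneg _).trans (hJ.abs_sum_le (d := a) (fun j => le_rfl) (X 0 ω))
  have hright : ∀ v : ℝ≥0, Tendsto (fun m : ℕ => ∫ ω in A, ψ (truncate m (ℓ (X v ω))) ∂P) atTop
      (𝓝 (∫ ω in A, ψ (ℓ (X v ω)) ∂P)) := fun v => by
    refine tendsto_integral_of_dominated_convergence (fun ω => 1 + ℓ (X v ω) ^ 2)
      (fun m => (hX.integrable_bounded_comp hJ (hc m) (hb m) v).aestronglyMeasurable.restrict)
      ((integrable_const _).add (hX.integrable_sq hJ h0 v)).restrict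
      (fun m => Eventually.of_forall fun ω => ?_) (Eventually.of_forall fun ω => ?_)
    · exact (hgrowth _).trans (add_le_add_right (hsq m _) _)
    · exact (hψ.tendsto _).comp (tendsto_truncate _)
  have hpt : ∀ (m : ℕ) (z : S), |jumpSum ℓ r a (fun y => ψ (truncate m y)) z| ≤
      2 * (R * ∑ j, |a j|) * |ℓ z| + R * ∑ j, |a j| * (1 + |a j|) := fun m z => by
    refine (hJ.abs_sum_le (fun j => hinc m _ (a j)) z).trans (le_of_eq ?_)
    simp only [mul_add, Finset.sum_add_distrib, ← Finset.sum_mul]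
    ring
  have hleft : Tendsto (fun m : ℕ => ∫ u in (s : ℝ)..t, ∫ ω in A,
      jumpSum ℓ r a (fun y => ψ (truncate m y)) (X u.toNNReal ω) ∂P) atTop
      (𝓝 (∫ u in (s : ℝ)..t, ∫ ω in A, jumpSum ℓ r a ψ (X u.toNNReal ω) ∂P)) := by
    -- Dominated convergence twice: in `ω` the dominating function is affine in `|ℓ (X u)|`, in `u`
    -- it is the constant obtained from its mean.
    refine intervalIntegral.tendsto_integral_filter_of_dominated_convergence
      (fun _ => 2 * (R * ∑ j, |a j|) * (R * (∑ j, |a j|) * t) + R * ∑ j, |a j| * (1 + |a j|))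
      (Eventually.of_forall fun m => (hX.measurable_setIntegral
        (hJ.measurable_jumpSum (hc m)) A).aestronglyMeasurable)
      (Eventually.of_forall fun m => Eventually.of_forall fun u hu => ?_)
      intervalIntegrable_const (Eventually.of_forall fun u hu => ?_)
    · rw [uIoc_of_le (NNReal.coe_le_coe.2 hst)] at hu
      obtain ⟨hi, hle⟩ := hX.integral_affine_le hJ h0 (p := 2 * (R * ∑ j, |a j|))
        (q := R * ∑ j, |a j| * (1 + |a j|)) (by positivity)
        (Real.toNNReal_le_iff_le_coe.2 hu.2)
      refine (norm_integral_le_integral_norm _).trans (le_trans ?_ hle)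
      refine (integral_mono (hX.integrable_bounded_jumpSum hJ (hc m) (hb m) _).norm.restrict
        hi.restrict fun ω => hpt m _).trans ?_
      exact setIntegral_le_integral hi (Eventually.of_forall fun ω =>
        (abs_nonneg _).trans (hpt 0 (X u.toNNReal ω)))
    · obtain ⟨hi, -⟩ := hX.integral_affine_le hJ h0 (p := 2 * (R * ∑ j, |a j|))
        (q := R * ∑ j, |a j| * (1 + |a j|)) (by positivity) (le_refl u.toNNReal)
      refine tendsto_integral_of_dominated_convergence _ (fun m =>
        (hX.integrable_bounded_jumpSum hJ (hc m) (hb m) _).aestronglyMeasurable.restrict)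
        hi.restrict (fun m => Eventually.of_forall fun ω => hpt m _)
        (Eventually.of_forall fun ω => ?_)
      refine tendsto_finsetSum _ fun j _ => tendsto_const_nhds.mul (Tendsto.sub ?_ ?_)
      · exact (hψ.tendsto _).comp (tendsto_truncate _)
      · exact (hψ.tendsto _).comp (tendsto_truncate _)
  refine tendsto_nhds_unique hleft ?_
  simp only [hdyn]
  exact (hright t).sub (hright s)

end JumpFunctional

/-! ### The martingales of a jump functional -/

theorem martingale_of_setIntegral_eq {Ω : Type*} {mΩ : MeasurableSpace Ω} {P : Measure Ω}
    [IsFiniteMeasure P] {𝓕 : Filtration ℝ≥0 mΩ} {M : ℝ≥0 → Ω → ℝ}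
    (hM : ∀ t, Measurable[𝓕 t] (M t)) (hi : ∀ t, Integrable (M t) P)
    (h : ∀ s t, s ≤ t → ∀ A, MeasurableSet[𝓕 s] A → ∫ ω in A, M s ω ∂P = ∫ ω in A, M t ω ∂P) :
    Martingale M 𝓕 P := by
  refine ⟨fun t => (hM t).stronglyMeasurable, fun s t hst => ?_⟩
  exact (ae_eq_condExp_of_forall_setIntegral_eq (𝓕.le s) (hi t)
    (fun A _ _ => (hi s).integrableOn) (fun A hA _ => h s t hst A hA)
    (hM s).stronglyMeasurable.aestronglyMeasurable).symm

theorem Martingale.setIntegral_mul_eq {Ω : Type*} {mΩ : MeasurableSpace Ω} {P : Measure Ω}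
    [IsFiniteMeasure P] {𝓕 : Filtration ℝ≥0 mΩ} {M : ℝ≥0 → Ω → ℝ} (hM : Martingale M 𝓕 P)
    {s t : ℝ≥0} (hst : s ≤ t) {A : Set Ω} (hA : MeasurableSet[𝓕 s] A) {g : Ω → ℝ}
    (hg : Measurable[𝓕 s] g) {B : ℝ} (hB : ∀ ω, |g ω| ≤ B) :
    ∫ ω in A, M t ω * g ω ∂P = ∫ ω in A, M s ω * g ω ∂P := by
  have hi : Integrable (fun ω => g ω * M t ω) P :=
    (hM.integrable t).bdd_mul (c := B) (hg.mono (𝓕.le s) le_rfl).aestronglyMeasurable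
      (Eventually.of_forall hB)
  have h1 : P[g * M t | 𝓕 s] =ᵐ[P] g * P[M t | 𝓕 s] :=
    condExp_stronglyMeasurable_mul_of_bound (𝓕.le s) hg.stronglyMeasurable (hM.integrable t) B
      (Eventually.of_forall hB)
  simp only [mul_comm (M _ _)]
  rw [← setIntegral_condExp (𝓕.le s) hi hA]
  refine setIntegral_congr_ae (𝓕.le s A hA) ?_
  filter_upwards [h1, hM.condExp_ae_eq hst] with ω h2 h3 _
  refine h2.trans ?_
  rw [Pi.mul_apply, h3]

section JumpMartingale

variable {Ω S J : Type*} [Fintype J] {mΩ : MeasurableSpace Ω} {P : Measure Ω}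
    [IsProbabilityMeasure P] {𝓕 : Filtration ℝ≥0 mΩ}
    [TopologicalSpace S] [TopologicalSpace.PseudoMetrizableSpace S] [MeasurableSpace S]
    [BorelSpace S] {X : ℝ≥0 → Ω → S} {L : (S → ℝ) → S → ℝ}
    {ℓ : S → ℝ} {r : J → S → ℝ} {a : J → ℝ} {R : ℝ}

theorem IsJumpFunctional.measurable_sum (hJ : IsJumpFunctional L ℓ r a R) (d : J → ℝ) :
    Measurable fun z => ∑ j, r j z * d j :=
  Finset.measurable_sum _ fun j _ => (hJ.measurable_rate j).mul_const _

theorem jumpSum_id (z : S) : jumpSum ℓ r a (fun y => y) z = ∑ j, r j z * a j := by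
  simp [jumpSum]

theorem jumpSum_sq (z : S) : jumpSum ℓ r a (fun y => y ^ 2) z =
    2 * (ℓ z * ∑ j, r j z * a j) + ∑ j, r j z * a j ^ 2 := by
  simp only [jumpSum, Finset.mul_sum, ← Finset.sum_add_distrib]
  exact Finset.sum_congr rfl fun j _ => by ring

theorem IsMarkovWithGenerator.measurable_comp_pathIntegral (hX : IsMarkovWithGenerator L 𝓕 P X)
    {b : S → ℝ} (hb : Measurable b) {B : ℝ} (hB : ∀ z, |b z| ≤ B) :
    Measurable fun p : ℝ≥0 × Ω => ∫ s in (0 : ℝ)..p.1, b (X s.toNNReal p.2) :=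
  measurable_uncurry_of_rightContinuous
    (X := fun t ω => ∫ s in (0 : ℝ)..t, b (X s.toNNReal ω))
    (fun t => (measurable_pathIntegral hX.adapted hX.rightContinuous hb t).mono (𝓕.le t) le_rfl)
    (fun ω _ => (continuous_pathIntegral (hX.rightContinuous ω) hb hB).continuousWithinAt)

theorem IsMarkovWithGenerator.integrable_pathIntegral (hX : IsMarkovWithGenerator L 𝓕 P X)
    {b : S → ℝ} (hb : Measurable b) {B : ℝ} (hB : ∀ z, |b z| ≤ B) (t : ℝ≥0) :
    Integrable (fun ω => ∫ s in (0 : ℝ)..t, b (X s.toNNReal ω)) P :=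
  Integrable.of_bound ((measurable_pathIntegral hX.adapted hX.rightContinuous hb t).mono
    (𝓕.le t) le_rfl).aestronglyMeasurable (B * |(t : ℝ) - 0|)
    (Eventually.of_forall fun ω => abs_pathIntegral_le hB (fun s => X s ω) 0 t)

theorem IsMarkovWithGenerator.pathIntegral_sub (hX : IsMarkovWithGenerator L 𝓕 P X)
    {b : S → ℝ} (hb : Measurable b) {B : ℝ} (hB : ∀ z, |b z| ≤ B) (s t : ℝ) (ω : Ω) :
    (∫ u in (0 : ℝ)..t, b (X u.toNNReal ω)) - ∫ u in (0 : ℝ)..s, b (X u.toNNReal ω) =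
      ∫ u in s..t, b (X u.toNNReal ω) := by
  have hi := intervalIntegrable_of_measurable_of_bound
    (measurable_comp_path_right (hX.rightContinuous ω) hb) (fun _ => hB _)
  exact intervalIntegral.integral_interval_sub_left (hi _ _) (hi _ _)

theorem IsMarkovWithGenerator.setIntegral_pathIntegral_sub (hX : IsMarkovWithGenerator L 𝓕 P X)
    {b : S → ℝ} (hb : Measurable b) {B : ℝ} (hB : ∀ z, |b z| ≤ B) (s t : ℝ≥0) (A : Set Ω) :
    (∫ ω in A, (∫ u in (0 : ℝ)..t, b (X u.toNNReal ω)) ∂P) -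
        ∫ ω in A, (∫ u in (0 : ℝ)..s, b (X u.toNNReal ω)) ∂P =
      ∫ u in (s : ℝ)..t, ∫ ω in A, b (X u.toNNReal ω) ∂P := by
  rw [← integral_sub (hX.integrable_pathIntegral hb hB t).restrict
    (hX.integrable_pathIntegral hb hB s).restrict]
  simp only [hX.pathIntegral_sub hb hB]
  have := intervalIntegral_setIntegral_swap (P := P) (g := fun _ => (1 : ℝ)) (integrable_const _)
    (measurable_comp_path hX.measurable hX.rightContinuous hb) (s := s) (t := t)
    (fun u _ ω => hB (X u.toNNReal ω)) A
  simpa using this.symm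

theorem IsMarkovWithGenerator.martingale (hX : IsMarkovWithGenerator L 𝓕 P X)
    (hJ : IsJumpFunctional L ℓ r a R) (h0 : ∀ᵐ ω ∂P, ℓ (X 0 ω) = 0) :
    Martingale (fun t ω => ℓ (X t ω) - ∫ s in (0 : ℝ)..t, ∑ j, r j (X s.toNNReal ω) * a j)
      𝓕 P := by
  have hb := hJ.measurable_sum a
  have hB : ∀ z, |∑ j, r j z * a j| ≤ R * ∑ j, |a j| := hJ.abs_sum_le fun j => le_rfl
  have hYi := fun t => (hX.first_moment hJ h0 t).1
  have hIi := hX.integrable_pathIntegral hb hB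
  refine martingale_of_setIntegral_eq (fun t => ?_) (fun t => (hYi t).sub (hIi t))
    fun s t hst A hA => ?_
  · exact (hJ.continuous.measurable.comp (hX.adapted t)).sub
      (measurable_pathIntegral hX.adapted hX.rightContinuous hb t)
  · rw [integral_sub (hYi s).restrict (hIi s).restrict,
      integral_sub (hYi t).restrict (hIi t).restrict]
    have h1 := hX.dynkin_of_growth hJ h0 (ψ := fun y => y) continuous_id
      (fun y => by rw [abs_le]; constructor <;> nlinarith [sq_nonneg (y - 1), sq_nonneg (y + 1)])
      (fun m y b => ?_) hst hA
    · simp only [jumpSum_id] at h1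
      have h2 := hX.setIntegral_pathIntegral_sub hb hB s t A
      linarith
    · have := abs_truncate_sub_le m (y + b) y
      rw [add_sub_cancel_left] at this
      exact this.trans (le_mul_of_one_le_right (abs_nonneg _)
        (by linarith [abs_nonneg y, abs_nonneg b]))

/-- Write `Y = M + I`, so `M² = Y² - 2 M I - I²`. On an event of `𝓕 s`, the means of `Y²`, `M I` and
`I²` grow at rates `E[2 Y b + γ]` (Dynkin), `E[M b]` (`M` is a martingale) and `2 E[I b]`
(calculus). Everything cancels except `E[γ]`, with no stochastic integration. -/
theorem IsMarkovWithGenerator.martingale_sq (hX : IsMarkovWithGenerator L 𝓕 P X)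
    (hJ : IsJumpFunctional L ℓ r a R) (h0 : ∀ᵐ ω ∂P, ℓ (X 0 ω) = 0) :
    Martingale (fun t ω => (ℓ (X t ω) - ∫ s in (0 : ℝ)..t, ∑ j, r j (X s.toNNReal ω) * a j) ^ 2 -
      ∫ s in (0 : ℝ)..t, ∑ j, r j (X s.toNNReal ω) * a j ^ 2) 𝓕 P := by
  have hmart := hX.martingale hJ h0
  set b : S → ℝ := fun z => ∑ j, r j z * a j
  set γ : S → ℝ := fun z => ∑ j, r j z * a j ^ 2
  have hb : Measurable b := hJ.measurable_sum a
  set B : ℝ := R * ∑ j, |a j|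
  have hB : ∀ z, |b z| ≤ B := hJ.abs_sum_le fun j => le_rfl
  have hγ : Measurable γ := hJ.measurable_sum fun j => a j ^ 2
  have hG : ∀ z, |γ z| ≤ R * ∑ j, |a j ^ 2| := hJ.abs_sum_le fun j => le_rfl
  set Y : ℝ≥0 → Ω → ℝ := fun t ω => ℓ (X t ω) with hY
  set I : ℝ≥0 → Ω → ℝ := fun t ω => ∫ s in (0 : ℝ)..t, b (X s.toNNReal ω) with hI
  set M : ℝ≥0 → Ω → ℝ := fun t ω => Y t ω - I t ω with hM
  set Γ : ℝ≥0 → Ω → ℝ := fun t ω => ∫ s in (0 : ℝ)..t, γ (X s.toNNReal ω) with hΓ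
  have hYm : ∀ t, Measurable[𝓕 t] (Y t) := fun t =>
    hJ.continuous.measurable.comp (hX.adapted t)
  have hIm : ∀ t, Measurable[𝓕 t] (I t) := fun t =>
    measurable_pathIntegral hX.adapted hX.rightContinuous hb t
  have hIb : ∀ t ω, |I t ω| ≤ B * t := fun t ω => by
    simpa using abs_pathIntegral_le hB (fun s => X s ω) 0 t
  have hIm' : ∀ t, AEStronglyMeasurable (I t) P := fun t =>
    ((hIm t).mono (𝓕.le t) le_rfl).aestronglyMeasurable
  have hYi : ∀ t, Integrable (Y t) P := fun t => (hX.first_moment hJ h0 t).1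
  have hY2 : ∀ t, Integrable (fun ω => Y t ω ^ 2) P := fun t => hX.integrable_sq hJ h0 t
  have hMi : ∀ t, Integrable (M t) P := hmart.integrable
  have hΓi : ∀ t, Integrable (Γ t) P := hX.integrable_pathIntegral hγ hG
  have hMI : ∀ t v, Integrable (fun ω => M t ω * I v ω) P := fun t v =>
    (hMi t).mul_bdd (c := B * v) (hIm' v) (Eventually.of_forall fun ω => hIb v ω)
  have hI2 : ∀ t, Integrable (fun ω => I t ω ^ 2) P := fun t => by
    have : Integrable (I t) P := hX.integrable_pathIntegral hb hB t
    simpa only [sq] using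
      this.mul_bdd (c := B * t) (hIm' t) (Eventually.of_forall fun ω => hIb t ω)
  have hexp : ∀ t ω, M t ω ^ 2 - Γ t ω = Y t ω ^ 2 - 2 * (M t ω * I t ω) - I t ω ^ 2 - Γ t ω :=
    fun t ω => by simp only [hM]; ring
  have hi : ∀ t, Integrable (fun ω => M t ω ^ 2 - Γ t ω) P := fun t => by
    simp only [hexp]
    exact (((hY2 t).sub ((hMI t t).const_mul 2)).sub (hI2 t)).sub (hΓi t)
  refine martingale_of_setIntegral_eq (fun t => ?_) hi fun s t hst A hA => ?_
  · exact (((hYm t).sub (hIm t)).pow_const 2).sub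
      (measurable_pathIntegral hX.adapted hX.rightContinuous hγ t)
  have hsplit : ∀ v, ∫ ω in A, (M v ω ^ 2 - Γ v ω) ∂P = (∫ ω in A, Y v ω ^ 2 ∂P) -
      2 * (∫ ω in A, M v ω * I v ω ∂P) - (∫ ω in A, I v ω ^ 2 ∂P) - ∫ ω in A, Γ v ω ∂P := by
    intro v
    simp only [hexp]
    have i1 : Integrable (fun ω => Y v ω ^ 2 - 2 * (M v ω * I v ω)) P :=
      (hY2 v).sub ((hMI v v).const_mul 2)
    have i2 : Integrable (fun ω => Y v ω ^ 2 - 2 * (M v ω * I v ω) - I v ω ^ 2) P :=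
      i1.sub (hI2 v)
    rw [integral_sub i2.restrict (hΓi v).restrict, integral_sub i1.restrict (hI2 v).restrict,
      integral_sub (hY2 v).restrict ((hMI v v).const_mul 2).restrict, integral_const_mul]
  have hst' : (s : ℝ) ≤ t := hst
  -- The Dynkin formula for the square
  have hsq := hX.dynkin_of_growth hJ h0 (ψ := fun y => y ^ 2) (continuous_pow 2)
    (fun y => by rw [abs_of_nonneg (sq_nonneg y)]; linarith)
    (fun m y b => (abs_truncate_sq_sub_le m y b).trans
      (mul_le_mul_of_nonneg_left (by linarith) (abs_nonneg _))) hst hA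
  simp only [jumpSum_sq] at hsq
  have hbX : Measurable fun p : ℝ × Ω => b (X p.1.toNNReal p.2) :=
    measurable_comp_path hX.measurable hX.rightContinuous hb
  have hIj : Measurable fun p : ℝ × Ω => I p.1.toNNReal p.2 :=
    (hX.measurable_comp_pathIntegral hb hB).comp
      ((measurable_real_toNNReal.comp measurable_fst).prodMk measurable_snd)
  have hB0 : 0 ≤ B := by
    obtain ⟨ω⟩ : Nonempty Ω := P.nonempty_of_neZero
    exact (abs_nonneg _).trans (hB (X 0 ω))
  have hIbX : ∀ u ∈ uIoc (s : ℝ) t, ∀ ω, |I u.toNNReal ω * b (X u.toNNReal ω)| ≤ B * t * B := by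
    intro u hu ω
    rw [uIoc_of_le hst'] at hu
    have hut : ((u.toNNReal : ℝ≥0) : ℝ) ≤ t := by
      exact_mod_cast Real.toNNReal_le_iff_le_coe.2 hu.2
    rw [abs_mul]
    exact mul_le_mul ((hIb _ ω).trans (mul_le_mul_of_nonneg_left hut hB0)) (hB _)
      (abs_nonneg _) (by positivity)
  have hIbm : Measurable fun p : ℝ × Ω => I p.1.toNNReal p.2 * b (X p.1.toNNReal p.2) :=
    hIj.mul hbX
  have hIbi : ∀ u ∈ uIoc (s : ℝ) t,
      Integrable (fun ω => I u.toNNReal ω * b (X u.toNNReal ω)) P := fun u hu =>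
    Integrable.of_bound (hIbm.comp measurable_prodMk_left).aestronglyMeasurable _
      (Eventually.of_forall (hIbX u hu))
  have hγi : ∀ u : ℝ≥0, Integrable (fun ω => γ (X u ω)) P := hX.integrable_comp hγ hG
  have hMb : ∀ u ∈ uIoc (s : ℝ) t, ∫ ω in A, M t ω * b (X u.toNNReal ω) ∂P =
      ∫ ω in A, M u.toNNReal ω * b (X u.toNNReal ω) ∂P := fun u hu => by
    rw [uIoc_of_le hst'] at hu
    have hsu : s ≤ u.toNNReal := (Real.le_toNNReal_iff_coe_le (s.2.trans hu.1.le)).2 hu.1.le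
    exact Martingale.setIntegral_mul_eq hmart (Real.toNNReal_le_iff_le_coe.2 hu.2)
      (𝓕.mono hsu A hA) (hb.comp (hX.adapted _)) (fun ω => hB _)
  -- the martingale part of the product of `M` with the compensator
  have hprod : (∫ ω in A, M t ω * I t ω ∂P) - ∫ ω in A, M s ω * I s ω ∂P =
      ∫ u in (s : ℝ)..t, ∫ ω in A, M u.toNNReal ω * b (X u.toNNReal ω) ∂P := by
    -- Replacing `M s * I s` by `M t * I s` turns the difference into `M t * (I t - I s)`; after
    -- Fubini, `hMb` moves `M t` back to `M u` inside the time integral.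
    rw [← Martingale.setIntegral_mul_eq hmart hst hA (hIm s) (hIb s),
      ← integral_sub (hMI t t).restrict (hMI t s).restrict]
    simp only [← mul_sub, hI, hX.pathIntegral_sub hb hB]
    rw [← intervalIntegral_setIntegral_swap (hMi t) hbX (fun u _ ω => hB _) A]
    exact intervalIntegral.integral_congr_ae (Eventually.of_forall hMb)
  have hI2sub : (∫ ω in A, I t ω ^ 2 ∂P) - ∫ ω in A, I s ω ^ 2 ∂P =
      2 * ∫ u in (s : ℝ)..t, ∫ ω in A, I u.toNNReal ω * b (X u.toNNReal ω) ∂P := by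
    have hsw := intervalIntegral_setIntegral_swap (P := P) (g := fun _ => (1 : ℝ))
      (integrable_const _) hIbm hIbX A
    simp only [one_mul] at hsw
    rw [hsw, ← integral_const_mul, ← integral_sub (hI2 t).restrict (hI2 s).restrict]
    refine integral_congr_ae (Eventually.of_forall fun ω => ?_)
    have h := integral_primitive_mul (f := fun u => b (X u.toNNReal ω))
      (measurable_comp_path_right (hX.rightContinuous ω) hb) (fun u => hB _) (NNReal.coe_nonneg s) hst'
    refine h.symm.trans ?_
    congr 1
    refine intervalIntegral.integral_congr fun u hu => ?_
    rw [uIcc_of_le hst'] at hu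
    simp only [hI, Real.coe_toNNReal u (s.2.trans hu.1)]
  have hΓsub := hX.setIntegral_pathIntegral_sub hγ hG s t A
  have hcombine : ∫ u in (s : ℝ)..t, ∫ ω in A,
      (2 * (ℓ (X u.toNNReal ω) * b (X u.toNNReal ω)) + γ (X u.toNNReal ω)) ∂P =
      2 * (∫ u in (s : ℝ)..t, ∫ ω in A, M u.toNNReal ω * b (X u.toNNReal ω) ∂P) +
      2 * (∫ u in (s : ℝ)..t, ∫ ω in A, I u.toNNReal ω * b (X u.toNNReal ω) ∂P) +
      ∫ u in (s : ℝ)..t, ∫ ω in A, γ (X u.toNNReal ω) ∂P := by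
    have hMj : Measurable fun p : ℝ × Ω => M p.1.toNNReal p.2 * b (X p.1.toNNReal p.2) :=
      ((measurable_comp_path hX.measurable hX.rightContinuous hJ.continuous.measurable).sub
        hIj).mul hbX
    have hMbi : ∀ u v : ℝ≥0, Integrable (fun ω => M u ω * b (X v ω)) P := fun u v =>
      (hMi u).mul_bdd (c := B) (hb.comp (hX.measurable v)).aestronglyMeasurable
        (Eventually.of_forall fun ω => hB _)
    have hint : ∀ {f : ℝ × Ω → ℝ}, Measurable f → ∀ c : ℝ,
        (∀ u ∈ uIoc (s : ℝ) t, |∫ ω in A, f (u, ω) ∂P| ≤ c) →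
        IntervalIntegrable (fun u => ∫ ω in A, f (u, ω) ∂P) volume s t := fun hf c hc =>
      (intervalIntegrable_const (c := c)).mono_fun'
        hf.stronglyMeasurable.integral_prod_right'.aestronglyMeasurable
        ((ae_restrict_mem measurableSet_uIoc).mono hc)
    have hle1 : (P.restrict A).real univ ≤ 1 := by
      rw [measureReal_restrict_apply_univ]; exact measureReal_le_one
    -- Exchanging `M u` for `M t` through `hMb` yields a bound independent of `u`.
    have i1 := (hint hMj (∫ ω, |M t ω| * B ∂P) fun u hu => by
      change |∫ ω in A, M u.toNNReal ω * b (X u.toNNReal ω) ∂P| ≤ _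
      rw [← hMb u hu]
      have hi2 : Integrable (fun ω => |M t ω| * B) P := (hMi t).abs.mul_const B
      refine (norm_integral_le_integral_norm _).trans ((integral_mono
        (hMbi t u.toNNReal).norm.restrict hi2.restrict fun ω => ?_).trans
        (setIntegral_le_integral hi2 (Eventually.of_forall fun ω => mul_nonneg (abs_nonneg _) hB0)))
      simp only [Real.norm_eq_abs, abs_mul]
      exact mul_le_mul_of_nonneg_left (hB _) (abs_nonneg _)).const_mul 2
    have i2 := (hint hIbm (B * t * B) fun u hu => by
      have h1 := norm_integral_le_of_norm_le_const (μ := P.restrict A)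
        (f := fun ω => I u.toNNReal ω * b (X u.toNNReal ω)) (Eventually.of_forall (hIbX u hu))
      exact h1.trans (mul_le_of_le_one_right (mul_nonneg (mul_nonneg hB0 t.2) hB0) hle1)
        ).const_mul 2
    have i3 := hint (measurable_comp_path hX.measurable hX.rightContinuous hγ)
      (R * ∑ j, |a j ^ 2|) fun u _ => hX.abs_setIntegral_le hG A u.toNNReal
    rw [← intervalIntegral.integral_const_mul, ← intervalIntegral.integral_const_mul,
      ← intervalIntegral.integral_add i1 i2, ← intervalIntegral.integral_add (i1.add i2) i3]
    refine intervalIntegral.integral_congr_ae (Eventually.of_forall fun u hu => ?_)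
    have j1 := ((hMbi u.toNNReal u.toNNReal).const_mul 2).restrict (s := A)
    have j2 := ((hIbi u hu).const_mul 2).restrict (s := A)
    have j3 := (hγi u.toNNReal).restrict (s := A)
    simp only [← integral_const_mul]
    have j12 : Integrable (fun ω => 2 * (M u.toNNReal ω * b (X u.toNNReal ω)) +
      2 * (I u.toNNReal ω * b (X u.toNNReal ω))) (P.restrict A) := j1.add j2
    rw [← integral_add j1 j2, ← integral_add j12 j3]
    refine integral_congr_ae (Eventually.of_forall fun ω => ?_)
    simp only [hM, hY]
    ring
  have e1 := hsplit s
  have e2 := hsplit t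
  rw [hcombine] at hsq
  simp only [hY, hΓ] at e1 e2 hΓsub ⊢
  rw [e1, e2]
  linarith

end JumpMartingale

/-! ### Càdlàg paths -/

section Cadlag

variable {S S' : Type*} [TopologicalSpace S] [TopologicalSpace S']

theorem IsCadlagPath.comp {u : ℝ≥0 → S} (hu : IsCadlagPath u) {f : S → S'} (hf : Continuous f) :
    IsCadlagPath fun t => f (u t) :=
  ⟨fun t => hf.continuousAt.comp_continuousWithinAt (hu.1 t), fun t ht =>
    let ⟨l, hl⟩ := hu.2 t ht
    ⟨f l, (hf.tendsto l).comp hl⟩⟩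

theorem IsCadlagPath.prodMk {u : ℝ≥0 → S} {v : ℝ≥0 → S'} (hu : IsCadlagPath u)
    (hv : IsCadlagPath v) : IsCadlagPath fun t => (u t, v t) :=
  ⟨fun t => (hu.1 t).prodMk (hv.1 t), fun t ht =>
    let ⟨l, hl⟩ := hu.2 t ht
    let ⟨m, hm⟩ := hv.2 t ht
    ⟨(l, m), hl.prodMk_nhds hm⟩⟩

theorem isCadlagPath_of_continuous {u : ℝ≥0 → S} (hu : Continuous u) : IsCadlagPath u :=
  ⟨fun _ => hu.continuousWithinAt, fun t _ => ⟨u t, (hu.tendsto t).mono_left nhdsWithin_le_nhds⟩⟩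

end Cadlag

/-! ### Expansion of the logarithm -/

/-- From `1 - 1/(1+x) ≤ log (1+x) ≤ x`. The lower gap is `x² (1 + 2x)/(1+x)`, nonnegative for `x ≥
-1/2`; the selection increment `-1/N` meets this because `N ≥ 2`. -/
theorem abs_log_one_add_sub_le {x : ℝ} (hx : -(1 / 2) ≤ x) :
    |Real.log (1 + x) - x| ≤ 2 * |x| ^ 2 := by
  have hpos : 0 < 1 + x := by linarith
  have h1 := Real.log_le_sub_one_of_pos hpos
  have h2 := Real.one_sub_inv_le_log_of_pos hpos
  have h3 : x - 2 * x ^ 2 ≤ 1 - (1 + x)⁻¹ := by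
    have h4 : 1 - (1 + x)⁻¹ - (x - 2 * x ^ 2) = x ^ 2 * (1 + 2 * x) * (1 + x)⁻¹ := by
      field_simp
      ring
    have h5 : 0 ≤ x ^ 2 * (1 + 2 * x) * (1 + x)⁻¹ :=
      mul_nonneg (mul_nonneg (sq_nonneg x) (by linarith)) (inv_nonneg.2 hpos.le)
    linarith
  rw [sq_abs, abs_le]
  constructor <;> nlinarith [sq_nonneg x]

theorem abs_log_one_add_sq_sub_le {x : ℝ} (hx : -(1 / 2) ≤ x) (hx1 : x ≤ 1) :
    |Real.log (1 + x) ^ 2 - x ^ 2| ≤ 8 * |x| ^ 3 := by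
  have h1 := abs_log_one_add_sub_le hx
  have hxa : |x| ≤ 1 := abs_le.2 ⟨by linarith, hx1⟩
  have h2 : |Real.log (1 + x) + x| ≤ 4 * |x| := by
    have h3 : Real.log (1 + x) + x = (Real.log (1 + x) - x) + 2 * x := by ring
    rw [h3]
    refine (abs_add_le _ _).trans ?_
    rw [abs_mul, abs_two]
    nlinarith [abs_nonneg x]
  rw [sq_sub_sq, mul_comm, abs_mul]
  calc |Real.log (1 + x) - x| * |Real.log (1 + x) + x|
      ≤ (2 * |x| ^ 2) * (4 * |x|) := mul_le_mul h1 h2 (abs_nonneg _) (by positivity)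
    _ = 8 * |x| ^ 3 := by ring

/-! ### The tilted rates -/

section Rates

variable {E : Type*} [TopologicalSpace E] [PolishSpace E] [MeasurableSpace E] [BorelSpace E]
  (D : JumpModel E) (k c : ℝ)

theorem JumpModel.isFiniteMeasure_W (x : E) : IsFiniteMeasure (D.W x) := by
  have := D.jump_markov
  unfold JumpModel.W
  exact Measure.smul_finite _ ENNReal.ofReal_ne_top

theorem JumpModel.tiltedRate_eq (x : E) :
    D.tiltedRate k x = D.rate x * ∫ y, Real.exp (k * D.g (x, y)) ∂D.jump x := by
  rw [JumpModel.tiltedRate, JumpModel.W, integral_smul_measure,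
    ENNReal.toReal_ofReal (D.rate_pos x).le, smul_eq_mul]

theorem JumpModel.exp_le (x y : E) :
    Real.exp (k * D.g (x, y)) ≤ Real.exp (|k| * ‖D.g‖) := by
  refine Real.exp_le_exp.2 ((le_abs_self _).trans ?_)
  rw [abs_mul]
  exact mul_le_mul_of_nonneg_left (D.g.norm_coe_le_norm _) (abs_nonneg _)

theorem JumpModel.continuous_exponent (x : E) : Continuous fun y => k * D.g (x, y) :=
  continuous_const.mul (D.g.continuous.comp (Continuous.prodMk_right x))

theorem JumpModel.integrable_exp (x : E) (μ : Measure E) [IsFiniteMeasure μ] :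
    Integrable (fun y => Real.exp (k * D.g (x, y))) μ :=
  Integrable.of_bound
    (Real.continuous_exp.comp (D.continuous_exponent k x)).measurable.aestronglyMeasurable
    (Real.exp (|k| * ‖D.g‖)) (Eventually.of_forall fun y => by
      rw [Real.norm_eq_abs, abs_of_pos (Real.exp_pos _)]
      exact D.exp_le k x y)

theorem JumpModel.tiltedRate_pos (x : E) : 0 < D.tiltedRate k x := by
  have := D.jump_markov
  rw [D.tiltedRate_eq]
  exact mul_pos (D.rate_pos x) (integral_exp_pos (D.integrable_exp k x (D.jump x)))

/-- A bound on the tilted rate. -/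
noncomputable def JumpModel.rateBound : ℝ := ‖D.rate‖ * Real.exp (|k| * ‖D.g‖)

theorem JumpModel.rateBound_nonneg : 0 ≤ D.rateBound k :=
  mul_nonneg (norm_nonneg _) (Real.exp_pos _).le

theorem JumpModel.rate_le_norm (x : E) : D.rate x ≤ ‖D.rate‖ :=
  (le_abs_self _).trans (D.rate.norm_coe_le_norm x)

theorem JumpModel.tiltedRate_le (x : E) : D.tiltedRate k x ≤ D.rateBound k := by
  have := D.jump_markov
  rw [D.tiltedRate_eq]
  refine mul_le_mul (D.rate_le_norm x) ?_ (integral_nonneg fun y => (Real.exp_pos _).le)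
    (norm_nonneg _)
  have h := integral_mono (D.integrable_exp k x (D.jump x)) (integrable_const _)
    (D.exp_le k x)
  simpa using h

/-- A bound on the negative part of the potential. -/
noncomputable def JumpModel.deficitBound : ℝ := ‖D.rate‖ + |k| * ‖D.h‖ + |c|

theorem JumpModel.deficitBound_nonneg : 0 ≤ D.deficitBound k c := by
  unfold JumpModel.deficitBound
  positivity

theorem JumpModel.deficit_nonneg (x : E) : 0 ≤ D.deficit k c x := le_max_left _ _

/-- The tilted rate enters `-(V_k - c)` with a negative sign and can be dropped. -/
theorem JumpModel.deficit_le (x : E) : D.deficit k c x ≤ D.deficitBound k c := by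
  refine max_le (D.deficitBound_nonneg k c) ?_
  have h1 := D.rate_le_norm x
  have h2 : -(k * D.h x) ≤ |k| * ‖D.h‖ := by
    refine (neg_le_abs _).trans ?_
    rw [abs_mul]
    exact mul_le_mul_of_nonneg_left (D.h.norm_coe_le_norm x) (abs_nonneg k)
  have h3 := (D.tiltedRate_pos k x).le
  have h4 := le_abs_self c
  simp only [JumpModel.potential, JumpModel.deficitBound]
  linarith

theorem JumpModel.excess_sub_deficit (x : E) :
    D.excess k c x - D.deficit k c x = D.potential k x - c := by
  unfold JumpModel.excess JumpModel.deficit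
  rcases le_total 0 (D.potential k x - c) with h | h
  · rw [max_eq_right h, max_eq_left (by linarith)]; ring
  · rw [max_eq_left h, max_eq_right (by linarith)]; ring

theorem JumpModel.measurable_tiltedRate : Measurable (D.tiltedRate k) := by
  have := D.jump_markov
  have h1 : (D.tiltedRate k) = fun x => D.rate x * ∫ y, Real.exp (k * D.g (x, y)) ∂D.jump x :=
    funext (D.tiltedRate_eq k)
  rw [h1]
  have h2 : StronglyMeasurable (Function.uncurry fun x y : E => Real.exp (k * D.g (x, y))) :=
    (Real.continuous_exp.comp
      (continuous_const.mul D.g.continuous)).measurable.stronglyMeasurable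
  exact D.rate.continuous.measurable.mul
    (StronglyMeasurable.integral_kernel_prod_right (κ := D.jump) h2).measurable

theorem JumpModel.measurable_deficit : Measurable (D.deficit k c) := by
  have h1 : Measurable (D.potential k) :=
    ((D.measurable_tiltedRate k).sub D.rate.continuous.measurable).add
      (D.h.continuous.measurable.const_mul k)
  exact measurable_const.max (h1.sub_const c).neg

theorem JumpModel.isProbabilityMeasure_tiltedJump (x : E) :
    IsProbabilityMeasure (D.tiltedJump k x) := by
  have := D.jump_markov
  have hfin := D.isFiniteMeasure_W x
  have : NeZero (D.W x) := ⟨fun h => by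
    have h1 := congrArg (fun μ : Measure E => μ univ) h
    have h2 := D.rate_pos x
    simp [JumpModel.W, not_le.2 h2] at h1⟩
  exact isProbabilityMeasure_tilted (D.integrable_exp k x (D.W x))

theorem integral_empirical {N : ℕ} (x : Fin N → E) (f : E → ℝ) :
    ∫ y, f y ∂empirical x = (N : ℝ)⁻¹ * ∑ i, f (x i) := by
  rw [empirical, integral_smul_measure, integral_finsetSum_measure]
  · simp
  · intro i _
    exact integrable_dirac (by simp)

end Rates

/-! ### The jumps of the logarithm of the cloning factor -/

section RateSum

variable {E : Type*} [TopologicalSpace E] [PolishSpace E] [MeasurableSpace E] [BorelSpace E]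
  {D : JumpModel E} {k c : ℝ} {K N : ℕ} {w : E → ℕ → ℝ}

/-- The rates at which the cloning factor is multiplied by `1 + n / N` (`some n`) and by
`1 - 1 / N` (`none`). -/
noncomputable def factorRate (D : JumpModel E) (k c : ℝ) (N : ℕ) (w : E → ℕ → ℝ) :
    Option (Fin (N + 1)) → State E N → ℝ
  | none, z => ∑ i, D.deficit k c (z.1 i)
  | some n, z => ∑ i, D.tiltedRate k (z.1 i) * w (z.1 i) n

/-- The relative increments of the cloning factor. -/
noncomputable def factorIncrement (N : ℕ) : Option (Fin (N + 1)) → ℝ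
  | none => -1 / N
  | some n => (n : ℕ) / N

theorem sum_factorRate_mul (θ : ℝ → ℝ) (z : State E N) :
    ∑ j, factorRate D k c N w j z * θ (factorIncrement N j) =
      ∑ i, (D.tiltedRate k (z.1 i) *
        (∑ n ∈ Finset.range (N + 1), w (z.1 i) n * θ (n / N)) +
        D.deficit k c (z.1 i) * θ (-1 / N)) := by
  rw [Fintype.sum_option, Finset.sum_add_distrib, add_comm]
  congr 1
  · simp only [factorRate, factorIncrement, Finset.sum_mul, Finset.mul_sum]
    rw [Finset.sum_comm]
    refine Finset.sum_congr rfl fun i _ => ?_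
    rw [Finset.sum_range]
    exact Finset.sum_congr rfl fun n _ => by ring
  · simp only [factorRate, factorIncrement, Finset.sum_mul]

theorem IsCloneSizeDistribution.le_one (hw : IsCloneSizeDistribution D k c K N w) (x : E) {n : ℕ}
    (hn : n ≤ N) : w x n ≤ 1 := by
  rw [← hw.sum_eq_one x]
  exact Finset.single_le_sum (f := fun n => w x n) (fun m _ => hw.nonneg x m)
    (Finset.mem_range.2 (by omega))

theorem measurable_factorRate (hw : IsCloneSizeDistribution D k c K N w)
    (j : Option (Fin (N + 1))) : Measurable (factorRate D k c N w j) := by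
  have hx : ∀ i : Fin N, Measurable fun z : State E N => z.1 i := fun i =>
    (measurable_pi_apply i).comp measurable_fst
  cases j with
  | none => exact Finset.measurable_sum _ fun i _ => (D.measurable_deficit k c).comp (hx i)
  | some n => exact Finset.measurable_sum _ fun i _ =>
      ((D.measurable_tiltedRate k).comp (hx i)).mul ((hw.measurable n).comp (hx i))

theorem factorRate_nonneg (hw : IsCloneSizeDistribution D k c K N w)
    (j : Option (Fin (N + 1))) (z : State E N) : 0 ≤ factorRate D k c N w j z := by
  cases j with
  | none => exact Finset.sum_nonneg fun i _ => D.deficit_nonneg k c _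
  | some n => exact Finset.sum_nonneg fun i _ =>
      mul_nonneg (D.tiltedRate_pos k _).le (hw.nonneg _ _)

theorem factorRate_le (hw : IsCloneSizeDistribution D k c K N w)
    (j : Option (Fin (N + 1))) (z : State E N) :
    factorRate D k c N w j z ≤ N * (D.rateBound k + D.deficitBound k c) := by
  have h1 := D.rateBound_nonneg k
  have h2 := D.deficitBound_nonneg k c
  have key : ∀ f : Fin N → ℝ, (∀ i, f i ≤ D.rateBound k + D.deficitBound k c) →
      ∑ i, f i ≤ N * (D.rateBound k + D.deficitBound k c) := fun f hf => by
    have h := Finset.sum_le_card_nsmul Finset.univ f _ fun i _ => hf i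
    rwa [Finset.card_univ, Fintype.card_fin, nsmul_eq_mul] at h
  cases j with
  | none => exact key _ fun i => (D.deficit_le k c _).trans (by linarith)
  | some n =>
    refine key _ fun i => ?_
    have h3 := mul_le_mul (D.tiltedRate_le k (z.1 i)) (hw.le_one (z.1 i) (Fin.is_le n))
      (hw.nonneg _ _) h1
    linarith

theorem log_rescale (s : Ioi (0 : ℝ)) (n : ℤ) (hn : -(N : ℤ) < n) :
    Real.log (rescale N s n hn) = Real.log s + Real.log (1 + n / N) := by
  have hs : (0 : ℝ) < s := s.2
  have hr : 0 < (s : ℝ) * (1 + n / N) := (rescale N s n hn).2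
  exact Real.log_mul hs.ne' (pos_of_mul_pos_right hr hs.le).ne'

/-- There are `N.choose n` sets of size `n`, which cancels the normalization of `cloneSetProb`. -/
theorem sum_cloneSetProb_mul (x : E) (θ : ℕ → ℝ) :
    ∑ A : Finset (Fin N), cloneSetProb w x A * θ A.card =
      ∑ n ∈ Finset.range (N + 1), w x n * θ n := by
  have h := Finset.sum_powerset_apply_card (fun n => w x n / (N.choose n : ℝ) * θ n)
    (x := (Finset.univ : Finset (Fin N)))
  rw [Finset.powerset_univ, Finset.card_univ, Fintype.card_fin] at h
  refine h.trans (Finset.sum_congr rfl fun n hn => ?_)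
  have hc : (N.choose n : ℝ) ≠ 0 := by
    exact_mod_cast (Nat.choose_pos (Nat.lt_succ_iff.1 (Finset.mem_range.1 hn))).ne'
  rw [nsmul_eq_mul]
  field_simp

theorem generator_comp_log (hN : 2 ≤ N) (ψ : ℝ → ℝ) (z : State E N) :
    generator D k c hN w (fun z => ψ (Real.log z.2)) z =
      jumpSum (fun z : State E N => Real.log z.2) (factorRate D k c N w)
        (fun j => Real.log (1 + factorIncrement N j)) ψ z := by
  have hN0 : 0 < N := by omega
  have hNr : (N : ℝ) ≠ 0 := by exact_mod_cast hN0.ne'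
  have := D.isProbabilityMeasure_tiltedJump k
  rw [jumpSum, sum_factorRate_mul
    (fun x => ψ (Real.log z.2 + Real.log (1 + x)) - ψ (Real.log z.2)), generator]
  refine Finset.sum_congr rfl fun i _ => ?_
  congr 1
  · congr 1
    -- The integrand no longer depends on `y`, and `tiltedJump` has mass one.
    simp only [log_rescale, integral_const, probReal_univ, one_smul]
    have h := sum_cloneSetProb_mul (N := N) (w := w) (z.1 i)
      (fun n => ψ (Real.log z.2 + Real.log (1 + n / N)) - ψ (Real.log z.2))
    simpa using h
  · simp only [log_rescale, Finset.sum_const, Finset.card_univ, Fintype.card_fin,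
      nsmul_eq_mul]
    push_cast
    field_simp

/-- The rate bound grows with `N`, which is harmless: it only serves integrability, while the error
constants come from `abs_sum_factorRate_mul_le`. -/
theorem isJumpFunctional_log (hw : IsCloneSizeDistribution D k c K N w) (hN : 2 ≤ N) :
    IsJumpFunctional (generator D k c hN w) (fun z : State E N => Real.log z.2)
      (factorRate D k c N w) (fun j => Real.log (1 + factorIncrement N j))
      (N * (D.rateBound k + D.deficitBound k c)) where
  continuous := (continuous_subtype_val.comp continuous_snd).log fun z => (ne_of_gt z.2.2)
  measurable_rate := measurable_factorRate hw
  rate_nonneg := factorRate_nonneg hw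
  rate_le := factorRate_le hw
  generator_eq ψ _ _ z := generator_comp_log hN ψ z

/-- The prescribed mean clone number cancels the tilted rate, leaving `(V_k - c)⁺ - (V_k - c)⁻ = V_k
- c` for each particle. No error arises here. -/
theorem sum_factorRate_mul_increment (hw : IsCloneSizeDistribution D k c K N w) (hN : 2 ≤ N)
    (z : State E N) :
    ∑ j, factorRate D k c N w j z * factorIncrement N j =
      (∫ x, D.potential k x ∂empirical z.1) - c := by
  have hN0 : (N : ℝ) ≠ 0 := by exact_mod_cast (by omega : N ≠ 0)
  rw [sum_factorRate_mul (fun x => x), integral_empirical]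
  have h1 : ∀ x, ∑ n ∈ Finset.range (N + 1), w x n * ((n : ℝ) / N) =
      (N : ℝ)⁻¹ * (D.excess k c x / D.tiltedRate k x) := fun x => by
    rw [← hw.mean x, Finset.mul_sum, Finset.range_eq_Ico,
      Finset.sum_eq_sum_Ico_succ_bot (by omega)]
    simp only [Nat.cast_zero, zero_div, mul_zero, zero_add]
    exact Finset.sum_congr rfl fun n _ => by ring
  have h2 : ∀ x, D.tiltedRate k x * ((N : ℝ)⁻¹ * (D.excess k c x / D.tiltedRate k x)) +
      D.deficit k c x * (-1 / N) = (N : ℝ)⁻¹ * D.potential k x - (N : ℝ)⁻¹ * c := fun x => by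
    have hne := (D.tiltedRate_pos k x).ne'
    rw [← mul_sub, ← D.excess_sub_deficit k c x]
    field_simp
    ring
  simp only [h1, h2, Finset.sum_sub_distrib, ← Finset.mul_sum, Finset.sum_const, Finset.card_univ,
    Fintype.card_fin, nsmul_eq_mul]
  field_simp

theorem sum_factorRate_mul_increment_sq (hN : 2 ≤ N) (z : State E N) :
    ∑ j, factorRate D k c N w j z * factorIncrement N j ^ 2 =
      1 / (N : ℝ) * ∫ x, (D.tiltedRate k x * secondMoment N w x + D.deficit k c x)
        ∂empirical z.1 := by
  have hN0 : (N : ℝ) ≠ 0 := by exact_mod_cast (by omega : N ≠ 0)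
  rw [sum_factorRate_mul (fun x => x ^ 2), integral_empirical, Finset.mul_sum, Finset.mul_sum]
  refine Finset.sum_congr rfl fun i _ => ?_
  have h1 : ∀ x, ∑ n ∈ Finset.range (N + 1), w x n * ((n : ℝ) / N) ^ 2 =
      (N : ℝ)⁻¹ * (N : ℝ)⁻¹ * secondMoment N w x := fun x => by
    rw [secondMoment, Finset.mul_sum, Finset.range_eq_Ico,
      Finset.sum_eq_sum_Ico_succ_bot (by omega)]
    simp only [Nat.cast_zero, zero_div, ne_eq, OfNat.ofNat_ne_zero, not_false_eq_true, zero_pow,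
      mul_zero, zero_add]
    exact Finset.sum_congr rfl fun n _ => by ring
  rw [h1]
  ring

/-- Clone numbers stay below `K`, so every increment that occurs is `O(1/N)` and `θ` of it is
`O(N^{-(p+1)})`; the sum over `N` particles costs one power of `N`. The conditions `2 ≤ N` and `K ≤
N` keep the increments in `[-1/2, 1]`. -/
theorem abs_sum_factorRate_mul_le (hw : IsCloneSizeDistribution D k c K N w) (hN : 2 ≤ N)
    (hK : K ≤ N) {θ : ℝ → ℝ} {C : ℝ} (hC : 0 ≤ C) (p : ℕ)
    (hθ : ∀ x, -(1 / 2) ≤ x → x ≤ 1 → |θ x| ≤ C * |x| ^ (p + 1)) (z : State E N) :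
    |∑ j, factorRate D k c N w j z * θ (factorIncrement N j)| ≤
      C * (D.rateBound k * K ^ (p + 1) + D.deficitBound k c) / (N : ℝ) ^ p := by
  have hNpos : (0 : ℝ) < N := by exact_mod_cast (by omega : 0 < N)
  have hN2 : (2 : ℝ) ≤ N := by exact_mod_cast hN
  have hL := D.rateBound_nonneg k
  rw [sum_factorRate_mul]
  have hclone : ∀ x, |∑ n ∈ Finset.range (N + 1), w x n * θ (n / N)| ≤
      C * (K / N) ^ (p + 1) := fun x => by
    have h1 : ∀ n ∈ Finset.range (N + 1), |w x n * θ (n / N)| ≤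
        w x n * (C * (K / N) ^ (p + 1)) := fun n hn => by
      rw [abs_mul, abs_of_nonneg (hw.nonneg x n)]
      rcases le_or_gt K n with hnK | hnK
      · simp [hw.bounded_support x n hnK]
      · refine mul_le_mul_of_nonneg_left ?_ (hw.nonneg x n)
        have hnN : (n : ℝ) ≤ N := by exact_mod_cast (hnK.le.trans hK)
        have hn0 : (0 : ℝ) ≤ n / N := by positivity
        refine (hθ _ (by linarith) ((div_le_one hNpos).2 hnN)).trans ?_
        rw [abs_of_nonneg hn0]
        have : (n : ℝ) ≤ K := by exact_mod_cast hnK.le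
        gcongr
    refine (Finset.abs_sum_le_sum_abs _ _).trans ((Finset.sum_le_sum h1).trans (le_of_eq ?_))
    rw [← Finset.sum_mul, hw.sum_eq_one x, one_mul]
  have hsel : |θ (-1 / N)| ≤ C * (1 / N) ^ (p + 1) := by
    have h2 : (1 : ℝ) / N ≤ 1 / 2 := one_div_le_one_div_of_le (by norm_num) hN2
    have h3 : (0 : ℝ) ≤ 1 / N := by positivity
    have h4 : (-1 : ℝ) / N = -(1 / N) := by ring
    rw [h4]
    refine (hθ _ (by linarith) (by linarith)).trans ?_
    rw [abs_neg, abs_of_nonneg h3]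
  refine (Finset.abs_sum_le_sum_abs _ _).trans ?_
  have hterm : ∀ i ∈ (Finset.univ : Finset (Fin N)), |D.tiltedRate k (z.1 i) *
        (∑ n ∈ Finset.range (N + 1), w (z.1 i) n * θ (n / N)) +
        D.deficit k c (z.1 i) * θ (-1 / N)| ≤
      D.rateBound k * (C * (K / N) ^ (p + 1)) + D.deficitBound k c * (C * (1 / N) ^ (p + 1)) := by
    intro i _
    refine (abs_add_le _ _).trans (add_le_add ?_ ?_)
    · rw [abs_mul, abs_of_pos (D.tiltedRate_pos k _)]
      exact mul_le_mul (D.tiltedRate_le k _) (hclone _) (abs_nonneg _) hL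
    · rw [abs_mul, abs_of_nonneg (D.deficit_nonneg k c _)]
      exact mul_le_mul (D.deficit_le k c _) hsel (abs_nonneg _) (D.deficitBound_nonneg k c)
  refine (Finset.sum_le_card_nsmul _ _ _ hterm).trans (le_of_eq ?_)
  simp only [Finset.card_univ, Fintype.card_fin, nsmul_eq_mul, div_pow, one_pow, pow_succ]
  field_simp

end RateSum

end Cloning

/-! ### The expansions of the compensator and of the bracket -/

theorem proposition5 {E : Type*} [TopologicalSpace E] [PolishSpace E]
    [LocallyCompactSpace E] [MeasurableSpace E] [BorelSpace E]
    (D : Cloning.JumpModel E) (k c : ℝ) (K : ℕ) :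
    -- one constant for all population sizes, times and paths
    ∃ B : ℝ, ∀ (N : ℕ) (hN : 2 ≤ N) (_ : K ≤ N) (w : E → ℕ → ℝ)
      (_ : Cloning.IsCloneSizeDistribution D k c K N w)
      (Ω : Type*) (mΩ : MeasurableSpace Ω) (P : Measure Ω) (_ : IsProbabilityMeasure P)
      (𝓕 : Filtration ℝ≥0 mΩ)
      (ζ : ℝ≥0 → Ω → Fin N → E) (C : ℝ≥0 → Ω → Ioi (0 : ℝ))
      (_ : Cloning.IsMarkovWithGenerator (Cloning.generator D k c hN w) 𝓕 P
        fun t ω => (ζ t ω, C t ω))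
      (_ : ∀ᵐ ω ∂P, (C 0 ω : ℝ) = 1),
      -- the time integrals are well defined
      (∀ (t : ℝ≥0) (ω : Ω),
        IntervalIntegrable (fun s : ℝ => Cloning.generator D k c hN w (fun z => Real.log z.2)
          (ζ s.toNNReal ω, C s.toNNReal ω)) volume 0 t ∧
        IntervalIntegrable (fun s : ℝ =>
          ∫ x, D.potential k x ∂Cloning.empirical (ζ s.toNNReal ω)) volume 0 t ∧
        IntervalIntegrable (fun s : ℝ =>
          ∫ x, (D.tiltedRate k x * Cloning.secondMoment N w x + D.deficit k c x)
            ∂Cloning.empirical (ζ s.toNNReal ω)) volume 0 t) ∧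
      Cloning.IsLocalMartingale (Cloning.compensatedLogFactor D k c hN w ζ C) 𝓕 P ∧
      (∀ (t : ℝ≥0) (ω : Ω),
        |Cloning.compensatedLogFactor D k c hN w ζ C t ω -
          (Real.log (C t ω) - ∫ s in (0 : ℝ)..t,
            ((∫ x, D.potential k x ∂Cloning.empirical (ζ s.toNNReal ω)) - c))|
          ≤ t * (B / N)) ∧
      ∃ R : ℝ≥0 → Ω → ℝ,
        (∀ t ω, |R t ω| ≤ t * (B / (N : ℝ) ^ 2)) ∧
        Cloning.IsPredictableQuadraticVariation (Cloning.compensatedLogFactor D k c hN w ζ C)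
          (fun t ω => 1 / (N : ℝ) * (∫ s in (0 : ℝ)..t,
            ∫ x, (D.tiltedRate k x * Cloning.secondMoment N w x + D.deficit k c x)
              ∂Cloning.empirical (ζ s.toNNReal ω)) + R t ω) 𝓕 P := by
  open Cloning in
  have hΛ := D.rateBound_nonneg k
  have hδ := D.deficitBound_nonneg k c
  -- The constants of `abs_sum_factorRate_mul_le` for `p = 1` and `p = 2`, with prefactors from the
  -- two logarithm estimates; their sum serves both error terms.
  set B₁ : ℝ := 2 * (D.rateBound k * K ^ 2 + D.deficitBound k c)
  set B₂ : ℝ := 8 * (D.rateBound k * K ^ 3 + D.deficitBound k c)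
  have hB₁0 : 0 ≤ B₁ := by positivity
  have hB₂0 : 0 ≤ B₂ := by positivity
  refine ⟨B₁ + B₂, fun N hN hK w hw Ω mΩ P hP 𝓕 ζ C hX hC => ?_⟩
  have hNpos : (0 : ℝ) < N := by exact_mod_cast (by omega : 0 < N)
  have hJ := isJumpFunctional_log hw hN
  have h0 : ∀ᵐ ω ∂P, Real.log ((ζ 0 ω, C 0 ω) : State E N).2 = 0 := by
    filter_upwards [hC] with ω hω
    simp [hω]
  -- `S θ` is the rate-weighted sum of `θ` over relative increments, kept opaque; every integrand
  -- below is `S θ` for some `θ`, up to affine changes.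
  obtain ⟨S, hS⟩ : ∃ S : (ℝ → ℝ) → State E N → ℝ, ∀ θ, S θ = fun z =>
    ∑ j, factorRate D k c N w j z * θ (factorIncrement N j) := ⟨_, fun _ => rfl⟩
  have hSm : ∀ θ, Measurable (S θ) := fun θ =>
    hS θ ▸ hJ.measurable_sum fun j => θ (factorIncrement N j)
  have hSb : ∀ θ, ∃ b, ∀ z, |S θ z| ≤ b := fun θ => by
    rw [hS]
    exact ⟨_, hJ.abs_sum_le (d := fun j => θ (factorIncrement N j)) fun j => le_rfl⟩
  have hrc := hX.rightContinuous
  have hSi : ∀ θ ω (t : ℝ), IntervalIntegrable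
      (fun s : ℝ => S θ (ζ s.toNNReal ω, C s.toNNReal ω)) volume 0 t := fun θ ω t => by
    obtain ⟨b, hb⟩ := hSb θ
    exact intervalIntegrable_of_measurable_of_bound
      (measurable_comp_path_right (hrc ω) (hSm θ)) (fun _ => hb _) _ _
  have hlog : ∀ z, generator D k c hN w (fun z => Real.log z.2) z =
      S (fun x => Real.log (1 + x)) z := fun z => by
    rw [generator_comp_log hN (fun y => y), jumpSum_id, hS]
  have hlin : ∀ z : State E N, ∫ x, D.potential k x ∂empirical z.1 = S (fun x => x) z + c :=
    fun z => by
      have := sum_factorRate_mul_increment hw hN z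
      simp only [hS]
      linarith
  have hquad : ∀ z : State E N,
      ∫ x, (D.tiltedRate k x * secondMoment N w x + D.deficit k c x) ∂empirical z.1 =
        N * S (fun x => x ^ 2) z := fun z => by
    simp only [hS, sum_factorRate_mul_increment_sq hN z]
    field_simp
  have hlin' : ∀ (s : ℝ≥0) ω, ∫ x, D.potential k x ∂empirical (ζ s ω) =
      S (fun x => x) (ζ s ω, C s ω) + c := fun s ω => hlin (ζ s ω, C s ω)
  have hquad' : ∀ (s : ℝ≥0) ω,
      ∫ x, (D.tiltedRate k x * secondMoment N w x + D.deficit k c x) ∂empirical (ζ s ω) =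
        N * S (fun x => x ^ 2) (ζ s ω, C s ω) := fun s ω => hquad (ζ s ω, C s ω)
  have hsub : ∀ θ₁ θ₂ (b : ℝ), (∀ z, |S (fun x => θ₁ x - θ₂ x) z| ≤ b) → ∀ (t : ℝ≥0) ω,
      |(∫ s in (0 : ℝ)..t, S θ₁ (ζ s.toNNReal ω, C s.toNNReal ω)) -
        ∫ s in (0 : ℝ)..t, S θ₂ (ζ s.toNNReal ω, C s.toNNReal ω)| ≤ t * b := by
    intro θ₁ θ₂ b hb t ω
    rw [← intervalIntegral.integral_sub (hSi _ _ _) (hSi _ _ _)]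
    have h1 := abs_pathIntegral_le hb (fun s => (ζ s ω, C s ω)) 0 t
    rw [sub_zero, abs_of_nonneg (NNReal.coe_nonneg t), mul_comm] at h1
    simpa only [hS, mul_sub, Finset.sum_sub_distrib] using h1
  have hM : compensatedLogFactor D k c hN w ζ C = fun t ω => Real.log (C t ω) -
      ∫ s in (0 : ℝ)..t, S (fun x => Real.log (1 + x)) (ζ s.toNNReal ω, C s.toNNReal ω) := by
    funext t ω
    simp only [compensatedLogFactor, hlog]
  have hYcad : ∀ ω, IsCadlagPath fun t => Real.log (C t ω) := fun ω =>
    (hX.cadlag ω).comp hJ.continuous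
  have hcont : ∀ θ ω, Continuous fun t : ℝ≥0 =>
      ∫ s in (0 : ℝ)..t, S θ (ζ s.toNNReal ω, C s.toNNReal ω) := fun θ ω => by
    obtain ⟨b, hb⟩ := hSb θ
    exact continuous_pathIntegral (hrc ω) (hSm θ) hb
  refine ⟨fun t ω => ⟨?_, ?_, ?_⟩, ?_, fun t ω => ?_, ?_⟩
  · simpa only [hlog] using hSi (fun x => Real.log (1 + x)) ω t
  · simp only [hlin']
    exact (hSi (fun x => x) ω t).add intervalIntegrable_const
  · simp only [hquad']
    exact (hSi (fun x => x ^ 2) ω t).const_mul _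
  · rw [hM]
    -- A true càdlàg martingale needs no localization.
    refine Locally.of_prop ⟨by simpa only [hS] using hX.martingale hJ h0, fun ω => ?_⟩
    exact ((hYcad ω).prodMk (isCadlagPath_of_continuous (hcont _ ω))).comp
      (f := fun p : ℝ × ℝ => p.1 - p.2) (by fun_prop)
  · rw [hM]
    simp only [hlin', add_sub_cancel_right]
    rw [sub_sub_sub_cancel_left, abs_sub_comm]
    refine hsub (fun x => Real.log (1 + x)) (fun x => x) _ (fun z => ?_) t ω
    have h1 := abs_sum_factorRate_mul_le hw hN hK (θ := fun x => Real.log (1 + x) - x)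
      (C := 2) (by norm_num) 1 (fun x hx _ => abs_log_one_add_sub_le hx) z
    rw [hS]
    refine h1.trans ?_
    rw [pow_one]
    exact div_le_div_of_nonneg_right (le_add_of_nonneg_right hB₂0) hNpos.le
  · refine ⟨fun t ω => (∫ s in (0 : ℝ)..t, S (fun x => Real.log (1 + x) ^ 2)
        (ζ s.toNNReal ω, C s.toNNReal ω)) -
        ∫ s in (0 : ℝ)..t, S (fun x => x ^ 2) (ζ s.toNNReal ω, C s.toNNReal ω),
      fun t ω => hsub (fun x => Real.log (1 + x) ^ 2) (fun x => x ^ 2) _ (fun z => ?_) t ω, ?_⟩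
    · have h1 := abs_sum_factorRate_mul_le hw hN hK (θ := fun x => Real.log (1 + x) ^ 2 - x ^ 2)
        (C := 8) (by norm_num) 2 (fun x hx hx1 => abs_log_one_add_sq_sub_le hx hx1) z
      rw [hS]
      exact h1.trans (div_le_div_of_nonneg_right (le_add_of_nonneg_left hB₁0) (by positivity))
    · have hA : (fun (t : ℝ≥0) ω => 1 / (N : ℝ) * (∫ s in (0 : ℝ)..t,
            ∫ x, (D.tiltedRate k x * secondMoment N w x + D.deficit k c x)
              ∂empirical (ζ s.toNNReal ω)) + ((∫ s in (0 : ℝ)..t, S (fun x => Real.log (1 + x) ^ 2)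
            (ζ s.toNNReal ω, C s.toNNReal ω)) -
            ∫ s in (0 : ℝ)..t, S (fun x => x ^ 2) (ζ s.toNNReal ω, C s.toNNReal ω))) =
          fun (t : ℝ≥0) ω => ∫ s in (0 : ℝ)..t, S (fun x => Real.log (1 + x) ^ 2)
            (ζ s.toNNReal ω, C s.toNNReal ω) := by
        funext t ω
        simp only [hquad', intervalIntegral.integral_const_mul]
        field_simp
        ring
      rw [hA, hM]
      have hnn : ∀ z, 0 ≤ S (fun x => Real.log (1 + x) ^ 2) z := fun z => by
        rw [hS]
        exact Finset.sum_nonneg fun j _ => mul_nonneg (factorRate_nonneg hw j z) (sq_nonneg _)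
      refine ⟨isStronglyPredictable_of_continuous
        (fun t => measurable_pathIntegral hX.adapted hrc (hSm _) t) (hcont (fun x => Real.log (1 + x) ^ 2)),
        fun ω => by simp, fun ω => isCadlagPath_of_continuous (hcont (fun x => Real.log (1 + x) ^ 2) ω),
        fun ω s t hst => ?_, Locally.of_prop
          ⟨by simpa only [hS] using hX.martingale_sq hJ h0, fun ω => ?_⟩⟩
      · exact intervalIntegral.integral_mono_interval le_rfl s.2 (NNReal.coe_le_coe.2 hst)
          (Eventually.of_forall fun u => hnn _) (hSi (fun x => Real.log (1 + x) ^ 2) ω t)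
      · exact ((hYcad ω).prodMk ((isCadlagPath_of_continuous
          (hcont (fun x => Real.log (1 + x)) ω)).prodMk
          (isCadlagPath_of_continuous (hcont (fun x => Real.log (1 + x) ^ 2) ω)))).comp
          (f := fun p : ℝ × ℝ × ℝ => (p.1 - p.2.1) ^ 2 - p.2.2) (by fun_prop)
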